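/- **Setting.** Manifolds are Hausdorff and second countable, and smooth means $C^\infty$; all functions in the function spaces are complex valued. Let $(\Sigma,g)$ be a complete connected smooth Riemannian manifold without boundary of dimension $n\ge 1$, with unit tangent bundle $S\Sigma$ and geodesic flow $\varphi^g:\mathbb R\times S\Sigma\to S\Sigma$. Let $\Omega\subset\Sigma$ be a closed subset that is an $n$-dimensional embedded smooth submanifold with boundary, with manifold interior $\mathring\Omega$, boundary $\partial\Omega$ and inward unit normal $n_x$ at $x\in\partial\Omega$ (pointing into $\Omega$). Put $M=S\Sigma|_{\Sigma\setminus\mathring\Omega}$, $\mathring M=S\Sigma|_{\Sigma\setminus\Omega}$, $\partial M=S\Sigma|_{\partial\Omega}$, and let $\partial_{\mathrm g}M$, $\partial_{\mathrm{in}}M$, $\partial_{\mathrm{out}}M$ be the sets of $(x,v)\in\partial M$ with $g_x(v,n_x)=0$, $>0$, $<0$, respectively. For $(x,v)\in\partial M$ let $v'=v-2g_x(v,n_x)n_x$. **Non-grazing billiard flow.** The trajectory of a point $(x,v)\in M\setminus\partial_{\mathrm g}M$ is $\varphi_0(x,v)=(x,v)$ at time $0$. Forward in time it follows $\varphi^g_t(x,v)$,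 or $\varphi^g_t(x,v')$ if $(x,v)\in\partial_{\mathrm{in}}M$, up to the first time $t>0$ at which this geodesic meets $\Omega$. If there it meets $\partial_{\mathrm g}M$, the trajectory ends and this time is excluded. Otherwise the trajectory is at the point of $\partial_{\mathrm{in}}M$ so reached at that time (unreflected), and it continues from this point by the same rule. Backward in time the same rule applies with $t<0$ and with $\partial_{\mathrm{in}}M$ and $\partial_{\mathrm{out}}M$ exchanged. This defines the trajectory on a maximal interval $(T_{\min}(x,v),T_{\max}(x,v))\ni 0$, whose endpoints are the limits of the successive collision times, so that infinitely many collisions in finite time also end the trajectory. Let $D\subset\mathbb R\times(M\setminus\partial_{\mathrm g}M)$ be the set of all $(t,x,v)$ with $T_{\min}(x,v)<t<T_{\max}(x,v)$. We obtain $\varphi:D\to M\setminus\partial_{\mathrm g}M$. **Billiard functions.** For an open set $O\subset M\setminus\partial_{\mathrm g}M$ such that $(x,v)\in O\cap\partial M$ implies $(x,v')\in O$, put $$C^\infty_{\mathrm{Bill}}(O)=\{f\in C^\infty(O): f\circ\varphi\in C^\infty(\varphi^{-1}(O))\},\qquad C^\infty_{\mathrm{Bill},c}(O)=C^\infty_{\mathrm{Bill}}(O)\cap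 C^\infty_c(O),$$ and define the billiard generator by $(\mathbf Pf)(q)=\frac{d}{dt}\big|_{t=0}f(\varphi_t(q))$ for $f\in C^\infty_{\mathrm{Bill}}(O)$, $q\in O$. **Smooth model.** A smooth model for $\varphi$ is a triple $(\mathcal M,\pi,\phi)$ of a smooth manifold $\mathcal M$, a smooth surjection $\pi:M\setminus\partial_{\mathrm g}M\to\mathcal M$ such that $\mathcal D=(\mathrm{id}_{\mathbb R}\times\pi)(D)$ is open in $\mathbb R\times\mathcal M$, and a smooth flow $\phi:\mathcal D\to\mathcal M$ (that is, $\phi_0=\mathrm{id}$, and $\phi_s(\phi_t(p))=\phi_{s+t}(p)$ whenever $(t,p)$, $(s,\phi_t(p))$ and $(s+t,p)$ lie in $\mathcal D$) such that $\pi|_{\mathring M}$ is a diffeomorphism onto its image, an open subset of $\mathcal M$, and $\phi_t(\pi(q))=\pi(\varphi_t(q))$ for all $(t,q)\in D$. **Proposition.** Let $(\mathcal M,\pi,\phi)$ be a smooth model for $\varphi$, let $\mathcal O\subset\mathcal M$ be open, and let $O=\pi^{-1}(\mathcal O)\subset M\setminus\partial_{\mathrm g}M$. Let $\mathbf X$ be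 the generator of $\phi$ on $C^\infty(\mathcal O)$, that is, $(\mathbf Xh)(p)=\frac{d}{dt}\big|_{t=0}h(\phi_t(p))$. Then the pullback $\pi^*:C^\infty(\mathcal O)\to C^\infty(O)$, $h\mapsto h\circ\pi$, is well defined and injective, and $$\pi^*(C^\infty(\mathcal O))=C^\infty_{\mathrm{Bill}}(O),\qquad \pi^*(C^\infty_c(\mathcal O))=C^\infty_{\mathrm{Bill},c}(O).$$ Moreover, the derivatives defining $\mathbf X$ and $\mathbf P$ exist, $\mathbf X$ is a linear operator on $C^\infty(\mathcal O)$ that preserves $C^\infty_c(\mathcal O)$, $\mathbf P$ is a linear operator on $C^\infty_{\mathrm{Bill}}(O)$ that preserves $C^\infty_{\mathrm{Bill},c}(O)$, and $$\pi^*\circ\mathbf X\circ(\pi^*)^{-1}=\mathbf P$$ as linear operators on $C^\infty_{\mathrm{Bill}}(O)$, and hence also on $C^\infty_{\mathrm{Bill},c}(O)$. -/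

import Mathlib

open scoped Manifold ContDiff Topology
open Set

noncomputable section

namespace Billiard

/-! ### Function spaces on subsets -/

section FunctionSpaces

variable {X : Type*}

/-- Extension of a function on a subset by zero (only ever inspected on, or close to, the subset). -/
def extendZero {S : Set X} (f : S → ℂ) : X → ℂ := Function.extend Subtype.val f 0

theorem extendZero_apply {S : Set X} (f : S → ℂ) {x : X} (hx : x ∈ S) :
    extendZero f x = f ⟨x, hx⟩ :=
  Subtype.val_injective.extend_apply f 0 (⟨x, hx⟩ : S)

theorem extendZero_zero {S : Set X} : extendZero (0 : S → ℂ) = 0 := by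
  classical
  funext x
  by_cases hx : x ∈ S
  · rw [extendZero_apply _ hx]; rfl
  · exact Function.extend_apply' _ _ _ (fun ⟨a, ha⟩ => hx (ha ▸ a.2))

theorem extendZero_add {S : Set X} (f h : S → ℂ) :
    extendZero (f + h) = extendZero f + extendZero h := by
  classical
  funext x
  by_cases hx : x ∈ S
  · simp only [Pi.add_apply, extendZero_apply _ hx]
  · have hn : ¬ ∃ a : S, (a : X) = x := fun ⟨a, ha⟩ => hx (ha ▸ a.2)
    simp [extendZero, Function.extend_apply' _ _ _ hn]

theorem extendZero_smul {S : Set X} (c : ℂ) (f : S → ℂ) :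
    extendZero (c • f) = c • extendZero f := by
  classical
  funext x
  by_cases hx : x ∈ S
  · simp only [Pi.smul_apply, extendZero_apply _ hx]
  · have hn : ¬ ∃ a : S, (a : X) = x := fun ⟨a, ha⟩ => hx (ha ▸ a.2)
    simp [extendZero, Function.extend_apply' _ _ _ hn]

variable {E H : Type*} [NormedAddCommGroup E] [NormedSpace ℝ E] [TopologicalSpace H]
  [TopologicalSpace X] [ChartedSpace H X]

theorem contMDiffOn_const_smul (I : ModelWithCorners ℝ E H) {S : Set X} {F : X → ℂ} (c : ℂ)
    (hF : ContMDiffOn I 𝓘(ℝ, ℂ) ∞ F S) : ContMDiffOn I 𝓘(ℝ, ℂ) ∞ (c • F) S :=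
  ((contDiff_const_smul (𝕜 := ℝ) (F := ℂ) (n := ∞) c).contMDiff.comp_contMDiffOn hF)

/-- `C^∞(S)`: the complex vector space of smooth functions `S → ℂ`, for a subset `S` of a
manifold. Smoothness is smoothness within `S` in the charts of the ambient manifold; if `S` is open,
or an embedded submanifold (possibly with boundary) of the ambient manifold, this is the
usual notion of smoothness on the manifold `S`. -/
def smoothFunctions (I : ModelWithCorners ℝ E H) (S : Set X) : Submodule ℂ (S → ℂ) where
  carrier := {f | ContMDiffOn I 𝓘(ℝ, ℂ) ∞ (extendZero f) S}
  zero_mem' := by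
    rw [mem_ofPred_eq, extendZero_zero]
    exact contMDiffOn_const
  add_mem' := by
    intro f h hf hh
    rw [mem_ofPred_eq, extendZero_add]
    exact ContMDiffOn.add hf hh
  smul_mem' := by
    intro c f hf
    rw [mem_ofPred_eq, extendZero_smul]
    exact contMDiffOn_const_smul I c hf

/-- The complex vector space of functions with compact support on a topological space. -/
def compactlySupportedFunctions (Y : Type*) [TopologicalSpace Y] : Submodule ℂ (Y → ℂ) where
  carrier := {f | HasCompactSupport f}
  zero_mem' := HasCompactSupport.zero
  add_mem' := fun hf hh => HasCompactSupport.add hf hh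
  smul_mem' := fun _ _ hf => HasCompactSupport.smul_left hf

end FunctionSpaces

/-! ### Geodesics -/

section Geometry

variable {n : ℕ} {Q : Type*} [TopologicalSpace Q] [ChartedSpace (EuclideanSpace ℝ (Fin n)) Q]
  [IsManifold (𝓡 n) ∞ Q]

/-- A smooth Riemannian metric on the `n`-dimensional manifold `Q`. -/
abbrev Metric (n : ℕ) (Q : Type*) [TopologicalSpace Q]
    [ChartedSpace (EuclideanSpace ℝ (Fin n)) Q] [IsManifold (𝓡 n) ∞ Q] : Type _ :=
  Bundle.ContMDiffRiemannianMetric (𝓡 n) ∞ (EuclideanSpace ℝ (Fin n))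
    (fun x : Q => TangentSpace (𝓡 n) x)

/-- The coefficients of the metric in the chart around `x₀`: at the coordinate point `u`, the
scalar product of the tangent vectors with coordinates `a` and `b`. -/
def metricInChart (g : Metric n Q) (x₀ : Q) (u a b : EuclideanSpace ℝ (Fin n)) : ℝ :=
  let y := (extChartAt (𝓡 n) x₀).symm u
  let e := trivializationAt (EuclideanSpace ℝ (Fin n)) (fun x : Q => TangentSpace (𝓡 n) x) x₀
  g.inner y (e.symmL ℝ y a) (e.symmL ℝ y b)

/-- A curve `γ : ℝ → Q` is a geodesic: it is smooth and in the standard charts of `Q` it satisfies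
the geodesic equation, here written with all indices lowered,
`G(u'', w) + (∂_{u'} G)(u', w) - (1 / 2) (∂_w G)(u', u') = 0` for all `w`. -/
def IsGeodesic (g : Metric n Q) (γ : ℝ → Q) : Prop :=
  ContMDiff 𝓘(ℝ, ℝ) (𝓡 n) ∞ γ ∧
  ∀ (x₀ : Q) (t : ℝ), γ t ∈ (extChartAt (𝓡 n) x₀).source →
    let u : ℝ → EuclideanSpace ℝ (Fin n) := fun s => extChartAt (𝓡 n) x₀ (γ s)
    let u' := deriv u t
    let u'' := deriv (deriv u) t
    ∀ w : EuclideanSpace ℝ (Fin n),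
      metricInChart g x₀ (u t) u'' w
        + fderiv ℝ (fun y => metricInChart g x₀ y u' w) (u t) u'
        - (1 / 2) * fderiv ℝ (fun y => metricInChart g x₀ y u' u') (u t) w = 0

/-- The velocity lift of a curve to the tangent bundle. -/
def velocityLift (γ : ℝ → Q) (t : ℝ) : TangentBundle (𝓡 n) Q :=
  ⟨γ t, mfderiv 𝓘(ℝ, ℝ) (𝓡 n) γ t (1 : ℝ)⟩

/-- (Geodesic) completeness: every tangent vector is the initial velocity of a geodesic that is
defined for all times. -/
def IsComplete (g : Metric n Q) : Prop :=
  ∀ q : TangentBundle (𝓡 n) Q, ∃ γ : ℝ → Q, IsGeodesic g γ ∧ velocityLift γ 0 = q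

open Classical in
/-- The geodesic flow on the tangent bundle of a complete Riemannian manifold; it
preserves the unit tangent bundle. -/
def geodesicFlow (g : Metric n Q) (t : ℝ) (q : TangentBundle (𝓡 n) Q) :
    TangentBundle (𝓡 n) Q :=
  if h : ∃ γ : ℝ → Q, IsGeodesic g γ ∧ velocityLift γ 0 = q then velocityLift h.choose t else q

/-! ### Obstacles and the phase space -/

/-- `ρ` is a smooth function near `x` with `ρ x = 0`, `dρ_x ≠ 0`, and `Ω = {ρ ≤ 0}` near `x`. -/
def IsLocalDefiningFunction (Ω : Set Q) (x : Q) (ρ : Q → ℝ) : Prop :=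
  ρ x = 0 ∧ mfderiv (𝓡 n) 𝓘(ℝ, ℝ) ρ x ≠ 0 ∧
    ∃ U : Set Q, IsOpen U ∧ x ∈ U ∧ ContMDiffOn (𝓡 n) 𝓘(ℝ, ℝ) ∞ ρ U ∧
      ∀ y ∈ U, (y ∈ Ω ↔ ρ y ≤ 0)

/-- `Ω` is a closed subset and an `n`-dimensional embedded smooth submanifold with boundary of the
`n`-dimensional manifold `Q`. Its manifold interior and boundary are then the topological
`interior Ω` and `frontier Ω`. -/
def IsObstacle (n : ℕ) {Q : Type*} [TopologicalSpace Q]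
    [ChartedSpace (EuclideanSpace ℝ (Fin n)) Q] (Ω : Set Q) : Prop :=
  IsClosed Ω ∧ ∀ x ∈ frontier Ω, ∃ ρ : Q → ℝ, IsLocalDefiningFunction (n := n) Ω x ρ

/-- `ν` is the unit normal vector of `∂Ω` at `x` that points into `Ω`. -/
def IsInwardUnitNormal (g : Metric n Q) (Ω : Set Q) (x : Q) (ν : TangentSpace (𝓡 n) x) : Prop :=
  g.inner x ν ν = 1 ∧ ∃ ρ : Q → ℝ, IsLocalDefiningFunction (n := n) Ω x ρ ∧
    ∃ c : ℝ, 0 < c ∧ ∀ w : TangentSpace (𝓡 n) x,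
      (mfderiv (𝓡 n) 𝓘(ℝ, ℝ) ρ x w : ℝ) = -c * g.inner x ν w

open Classical in
/-- The inward unit normal `n_x`, for `x ∈ ∂Ω`. -/
def inwardNormal (g : Metric n Q) (Ω : Set Q) (x : Q) : TangentSpace (𝓡 n) x :=
  if h : ∃ ν : TangentSpace (𝓡 n) x, IsInwardUnitNormal g Ω x ν then h.choose else 0

/-- The normal component `g_x(v, n_x)` of `q = (x, v)`. -/
def normalComponent (g : Metric n Q) (Ω : Set Q) (q : TangentBundle (𝓡 n) Q) : ℝ :=
  g.inner q.1 q.2 (inwardNormal g Ω q.1)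

/-- The unit tangent bundle. -/
def unitBundle (g : Metric n Q) : Set (TangentBundle (𝓡 n) Q) :=
  {q | g.inner q.1 q.2 q.2 = 1}

/-- The phase space `M`: unit tangent vectors over the complement of the interior of `Ω`. -/
def phaseSpace (g : Metric n Q) (Ω : Set Q) : Set (TangentBundle (𝓡 n) Q) :=
  {q | q ∈ unitBundle g ∧ q.1 ∉ interior Ω}

/-- The interior of the phase space: unit tangent vectors over the complement of `Ω`. -/
def phaseInterior (g : Metric n Q) (Ω : Set Q) : Set (TangentBundle (𝓡 n) Q) :=
  {q | q ∈ unitBundle g ∧ q.1 ∉ Ω}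

/-- The grazing boundary: unit vectors over `∂Ω` that are tangent to `∂Ω`. -/
def grazing (g : Metric n Q) (Ω : Set Q) : Set (TangentBundle (𝓡 n) Q) :=
  {q | q ∈ unitBundle g ∧ q.1 ∈ frontier Ω ∧ normalComponent g Ω q = 0}

/-- The non-grazing phase space `M ∖ ∂_g M`. -/
def nonGrazing (g : Metric n Q) (Ω : Set Q) : Set (TangentBundle (𝓡 n) Q) :=
  phaseSpace g Ω \ grazing g Ω

/-- The tangential reflection `(x, v) ↦ (x, v - 2 g_x(v, n_x) n_x)`. -/
def reflect (g : Metric n Q) (Ω : Set Q) (q : TangentBundle (𝓡 n) Q) : TangentBundle (𝓡 n) Q :=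
  ⟨q.1, q.2 - (2 * normalComponent g Ω q) • inwardNormal g Ω q.1⟩

/-! ### The non-grazing billiard flow

Forward (`σ = 1`) and backward (`σ = -1`) trajectories are treated simultaneously; the times below
are elapsed times, so that for `σ = -1` the actual times are their negatives. -/

open Classical in
/-- The vector with which the geodesic motion in the direction of time `σ` starts at `q`: this is
the reflection of `q` if `q` is in the inward boundary and `σ = 1`, or in the outward boundary and
`σ = -1`; otherwise it is `q`. -/
def start (g : Metric n Q) (Ω : Set Q) (σ : ℝ) (q : TangentBundle (𝓡 n) Q) :
    TangentBundle (𝓡 n) Q :=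
  if q.1 ∈ frontier Ω ∧ 0 < σ * normalComponent g Ω q then reflect g Ω q else q

/-- The time until the next encounter with the obstacles: `t_+(q)` for `σ = 1`, and `-t_-(q)`
for `σ = -1`. -/
def hitTime (g : Metric n Q) (Ω : Set Q) (σ : ℝ) (q : TangentBundle (𝓡 n) Q) : EReal :=
  sInf {τ : EReal | ∃ t : ℝ, 0 < t ∧ τ = (t : EReal) ∧
    (geodesicFlow g (σ * t) (start g Ω σ q)).1 ∈ Ω}

/-- The point in phase space at which this next encounter takes place, if `hitTime` is finite. -/
def hitPoint (g : Metric n Q) (Ω : Set Q) (σ : ℝ) (q : TangentBundle (𝓡 n) Q) :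
    TangentBundle (𝓡 n) Q :=
  geodesicFlow g (σ * (hitTime g Ω σ q).toReal) (start g Ω σ q)

open Classical in
/-- Time and place of the `k`-th non-grazing collision on the trajectory of `q`; it starts with
`(0, q)` for `k = 0` and remains constant after the last non-grazing collision. -/
def collision (g : Metric n Q) (Ω : Set Q) (σ : ℝ) (q : TangentBundle (𝓡 n) Q) :
    ℕ → ℝ × TangentBundle (𝓡 n) Q
  | 0 => (0, q)
  | k + 1 =>
    let c := collision g Ω σ q k
    if hitTime g Ω σ c.2 ≠ ⊤ ∧ hitPoint g Ω σ c.2 ∉ grazing g Ω then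
      (c.1 + (hitTime g Ω σ c.2).toReal, hitPoint g Ω σ c.2)
    else c

/-- The time up to which the trajectory of `q` is determined by its first `k` collisions:
`t_+^k(q)` for `σ = 1` and `-t_-^k(q)` for `σ = -1`. -/
def exitTime (g : Metric n Q) (Ω : Set Q) (σ : ℝ) (q : TangentBundle (𝓡 n) Q) (k : ℕ) : EReal :=
  ((collision g Ω σ q k).1 : EReal) + hitTime g Ω σ (collision g Ω σ q k).2

/-- `T_max(q)` for `σ = 1`, and `-T_min(q)` for `σ = -1`. -/
def lifetime (g : Metric n Q) (Ω : Set Q) (σ : ℝ) (q : TangentBundle (𝓡 n) Q) : EReal :=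
  ⨆ k : ℕ, exitTime g Ω σ q k

/-- The domain `D ⊆ ℝ × (M ∖ ∂_g M)` of the billiard flow: `T_min(q) < t < T_max(q)`. -/
def billiardDomain (g : Metric n Q) (Ω : Set Q) : Set (ℝ × TangentBundle (𝓡 n) Q) :=
  {p | p.2 ∈ nonGrazing g Ω ∧ -lifetime g Ω (-1) p.2 < (p.1 : EReal) ∧
    (p.1 : EReal) < lifetime g Ω 1 p.2}

/-- The point reached from `q` after the elapsed time `0 < t < lifetime g Ω σ q`: follow the
geodesic that starts at the last collision that takes place strictly before time `t`. -/
def advance (g : Metric n Q) (Ω : Set Q) (σ t : ℝ) (q : TangentBundle (𝓡 n) Q) :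
    TangentBundle (𝓡 n) Q :=
  let c := collision g Ω σ q (sInf {k : ℕ | (t : EReal) ≤ exitTime g Ω σ q k})
  geodesicFlow g (σ * (t - c.1)) (start g Ω σ c.2)

open Classical in
/-- The non-grazing billiard flow `φ_t(q)`, for `(t, q) ∈ billiardDomain g Ω`. -/
def billiardFlow (g : Metric n Q) (Ω : Set Q) (t : ℝ) (q : TangentBundle (𝓡 n) Q) :
    TangentBundle (𝓡 n) Q :=
  if 0 < t then advance g Ω 1 t q else if t < 0 then advance g Ω (-1) (-t) q else q

/-! ### Billiard functions and smooth models -/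

/-- The smooth billiard functions on `O`: the smooth functions `f` on `O` such that `f ∘ φ` is
smooth on `φ⁻¹(O) ⊆ D`. -/
def billiardFunctions (g : Metric n Q) (Ω : Set Q) (O : Set (TangentBundle (𝓡 n) Q)) :
    Submodule ℂ (O → ℂ) where
  carrier := {f | f ∈ smoothFunctions (𝓡 n).tangent O ∧
    ContMDiffOn (𝓘(ℝ, ℝ).prod (𝓡 n).tangent) 𝓘(ℝ, ℂ) ∞
      (fun p : ℝ × TangentBundle (𝓡 n) Q => extendZero f (billiardFlow g Ω p.1 p.2))
      {p ∈ billiardDomain g Ω | billiardFlow g Ω p.1 p.2 ∈ O}}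
  zero_mem' := by
    refine ⟨Submodule.zero_mem _, ?_⟩
    rw [extendZero_zero]
    exact contMDiffOn_const
  add_mem' := by
    rintro f h ⟨hf, hf'⟩ ⟨hh, hh'⟩
    refine ⟨Submodule.add_mem _ hf hh, ?_⟩
    rw [extendZero_add]
    exact ContMDiffOn.add hf' hh'
  smul_mem' := by
    rintro c f ⟨hf, hf'⟩
    refine ⟨Submodule.smul_mem _ c hf, ?_⟩
    rw [extendZero_smul]
    exact contMDiffOn_const_smul _ c hf'

variable {m : ℕ} {𝓜 : Type*} [TopologicalSpace 𝓜] [ChartedSpace (EuclideanSpace ℝ (Fin m)) 𝓜]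

/-- The domain `𝒟 = (id × π)(D)` of the model flow. -/
def modelDomain (g : Metric n Q) (Ω : Set Q) (π : TangentBundle (𝓡 n) Q → 𝓜) : Set (ℝ × 𝓜) :=
  (fun p : ℝ × TangentBundle (𝓡 n) Q => (p.1, π p.2)) '' billiardDomain g Ω

/-- `(𝓜, π, ϕ)` is a smooth model for the non-grazing billiard flow. The map `π` matters only on
`M ∖ ∂_g M`, and the flow `ϕ` only on `𝒟`. -/
structure IsSmoothModel (g : Metric n Q) (Ω : Set Q) (π : TangentBundle (𝓡 n) Q → 𝓜)
    (ϕ : ℝ → 𝓜 → 𝓜) : Prop where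
  /-- `π` is smooth on `M ∖ ∂_g M`. -/
  contMDiffOn_proj : ContMDiffOn (𝓡 n).tangent (𝓡 m) ∞ π (nonGrazing g Ω)
  /-- `π` maps `M ∖ ∂_g M` onto `𝓜`. -/
  surjOn_proj : SurjOn π (nonGrazing g Ω) univ
  /-- The domain `𝒟` is open. -/
  isOpen_domain : IsOpen (modelDomain g Ω π)
  /-- `ϕ` is smooth on `𝒟`. -/
  contMDiffOn_flow : ContMDiffOn (𝓘(ℝ, ℝ).prod (𝓡 m)) (𝓡 m) ∞
    (fun p : ℝ × 𝓜 => ϕ p.1 p.2) (modelDomain g Ω π)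
  /-- `ϕ` is a flow: identity at time zero. -/
  flow_zero : ∀ p : 𝓜, ϕ 0 p = p
  /-- `ϕ` is a flow: group law. -/
  flow_add : ∀ (s t : ℝ) (p : 𝓜), (t, p) ∈ modelDomain g Ω π → (s, ϕ t p) ∈ modelDomain g Ω π →
    (s + t, p) ∈ modelDomain g Ω π → ϕ s (ϕ t p) = ϕ (s + t) p
  /-- `π` restricted to the interior of `M` is a diffeomorphism onto its image, an open subset
  of `𝓜`. -/
  isOpen_image : IsOpen (π '' phaseInterior g Ω)
  exists_inverse : ∃ ψ : 𝓜 → TangentBundle (𝓡 n) Q,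
    ContMDiffOn (𝓡 m) (𝓡 n).tangent ∞ ψ (π '' phaseInterior g Ω) ∧
      ∀ q ∈ phaseInterior g Ω, ψ (π q) = q
  /-- `π` intertwines the flows. -/
  intertwine : ∀ p ∈ billiardDomain g Ω, ϕ p.1 (π p.2) = π (billiardFlow g Ω p.1 p.2)

/-- The preimage `O = π⁻¹(𝒪) ⊆ M ∖ ∂_g M`. -/
def preimageInPhase (g : Metric n Q) (Ω : Set Q) (π : TangentBundle (𝓡 n) Q → 𝓜) (𝒪 : Set 𝓜) :
    Set (TangentBundle (𝓡 n) Q) :=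
  nonGrazing g Ω ∩ π ⁻¹' 𝒪

/-- The pullback `π^* h = h ∘ π` of functions on `𝒪` to functions on `O = π⁻¹(𝒪)`. -/
def pullback (g : Metric n Q) (Ω : Set Q) (π : TangentBundle (𝓡 n) Q → 𝓜) (𝒪 : Set 𝓜) :
    (𝒪 → ℂ) →ₗ[ℂ] (preimageInPhase g Ω π 𝒪 → ℂ) :=
  LinearMap.funLeft ℂ ℂ (fun q : preimageInPhase g Ω π 𝒪 => (⟨π q.1, q.2.2⟩ : 𝒪))

end Geometry

/-- The linear operator `A` on a space `V` of functions on `S` is the generator of the family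
`Φ_t`: for all `f ∈ V` and all `x ∈ S`, the function `t ↦ f (Φ_t x)`, defined for `t` close to
zero, has the derivative `(A f) x` at `t = 0`. -/
def IsGenerator {X : Type*} {S : Set X} (V : Submodule ℂ (S → ℂ)) (Φ : ℝ → X → X)
    (A : V →ₗ[ℂ] V) : Prop :=
  ∀ (f : V) (x : S), HasDerivAt (fun t : ℝ => extendZero (f : S → ℂ) (Φ t x)) ((A f : S → ℂ) x) 0

end Billiard

end

open scoped Manifold ContDiff Topology
open Set

noncomputable section

/-! The model flow is smooth where the billiard flow jumps, and `π` is invertible over the interior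
of phase space. Questions at boundary points can therefore be moved into the interior by flowing for
a short time, answered there, and moved back.

Descent: two points in one fiber of `π` have the same trajectory for small `t > 0`, because it runs
in the interior, where `π` is injective (`eventually_billiardFlow_eq`). As `f ∘ φ` is continuous, `t
→ 0` shows that a billiard function `f` is constant on fibers, so `f = h ∘ π`. Near `p`, fix `t > 0`
such that `ϕ_t` maps into the image of the interior, and let `ψ` invert `π` there. Then `h p' = f
(φ_{-t} (ψ (ϕ_t p')))`, which is smooth because `f ∘ φ` is (`mem_smoothFunctions`). The other
inclusion is the identity `h ∘ π ∘ φ = h ∘ ϕ ∘ (id × π)` (`pullback_mem`).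

Compact supports correspond because `π` is proper (`isCompact_preimage`). Let `q` lie over the
boundary. A point with image close to `π q` is, up to reflection, reached in time `t` from an
interior point close to `φ_{-t} q`. In so short a time there is at most one collision, so the point
is close to the incoming or the outgoing vector at `q` (`eventually_fiber_subset`). Only this step
needs geometry that is uniform in the initial vector: short-time bounds for geodesics
(`exists_geodesicFlow_mem`) and for their transversal exit from `Ω` (`exists_geodesicFlow_notMem`).
Both follow from energy conservation and the geodesic equation, without uniqueness of geodesics or
continuous dependence on initial data.

Generators: `X` differentiates the smooth model flow. `P` is defined as its conjugate and is the
billiard generator because `f (φ_t q) = h (ϕ_t (π q))` for small `t`. -/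

namespace Billiard

set_option maxSynthPendingDepth 3
set_option linter.unusedSectionVars false

/-! ### Tangent vectors and the metric in charts -/

section Coordinates

variable {n : ℕ} {Q : Type*} [TopologicalSpace Q] [ChartedSpace (EuclideanSpace ℝ (Fin n)) Q]
  [IsManifold (𝓡 n) ∞ Q]

local notation "𝔼" => EuclideanSpace ℝ (Fin n)

/-- The trivialization of the tangent bundle over the chart at `x₀`. -/
abbrev tangentTriv (x₀ : Q) :
    Bundle.Trivialization (EuclideanSpace ℝ (Fin n))
      (Bundle.TotalSpace.proj : TangentBundle (𝓡 n) Q → Q) :=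
  trivializationAt (EuclideanSpace ℝ (Fin n)) (fun x : Q => TangentSpace (𝓡 n) x) x₀

/-- The coordinates of a tangent vector in the chart at `x₀`. -/
def tangentCoord (x₀ : Q) (q : TangentBundle (𝓡 n) Q) : EuclideanSpace ℝ (Fin n) :=
  (tangentTriv x₀ q).2

/-- The Riemannian metric in the chart at `x₀`, as a family of bilinear forms. -/
def metricForm (g : Metric n Q) (x₀ : Q) (u : EuclideanSpace ℝ (Fin n)) :
    EuclideanSpace ℝ (Fin n) →L[ℝ] EuclideanSpace ℝ (Fin n) →L[ℝ] ℝ :=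
  (ContinuousLinearMap.precomp ℝ ((tangentTriv x₀).symmL ℝ ((extChartAt (𝓡 n) x₀).symm u))).comp
    ((g.inner ((extChartAt (𝓡 n) x₀).symm u)).comp
      ((tangentTriv x₀).symmL ℝ ((extChartAt (𝓡 n) x₀).symm u)))

theorem metricForm_apply (g : Metric n Q) (x₀ : Q) (u a b : 𝔼) :
    metricForm g x₀ u a b = metricInChart g x₀ u a b := rfl

theorem symmL_tangentCoord {x₀ : Q} {q : TangentBundle (𝓡 n) Q}
    (hq : q.1 ∈ (extChartAt (𝓡 n) x₀).source) :
    (tangentTriv x₀).symmL ℝ q.1 (tangentCoord x₀ q) = q.2 := by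
  have hb : q.1 ∈ (tangentTriv x₀ : Bundle.Trivialization 𝔼
      (Bundle.TotalSpace.proj : TangentBundle (𝓡 n) Q → Q)).baseSet := by
    rwa [TangentBundle.trivializationAt_baseSet, ← extChartAt_source (𝓡 n)]
  have := (tangentTriv x₀).symmL_continuousLinearMapAt (R := ℝ) hb q.2
  rwa [Bundle.Trivialization.continuousLinearMapAt_apply,
    Bundle.Trivialization.coe_linearMapAt_of_mem _ hb] at this

theorem tangentCoord_symmL {x₀ y : Q} (hy : y ∈ (extChartAt (𝓡 n) x₀).source) (a : 𝔼) :
    tangentCoord x₀ (⟨y, (tangentTriv x₀).symmL ℝ y a⟩ : TangentBundle (𝓡 n) Q) = a := by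
  have hb : y ∈ (tangentTriv x₀ : Bundle.Trivialization 𝔼
      (Bundle.TotalSpace.proj : TangentBundle (𝓡 n) Q → Q)).baseSet := by
    rwa [TangentBundle.trivializationAt_baseSet, ← extChartAt_source (𝓡 n)]
  have := (tangentTriv x₀).continuousLinearMapAt_symmL (R := ℝ) hb a
  rwa [Bundle.Trivialization.continuousLinearMapAt_apply,
    Bundle.Trivialization.coe_linearMapAt_of_mem _ hb] at this

/-- The bridge between the bundle trivialization, in which the metric is written, and derivatives of
curves and functions read in the chart. -/
theorem tangentCoord_eq_mfderiv {x₀ : Q} {q : TangentBundle (𝓡 n) Q}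
    (hq : q.1 ∈ (extChartAt (𝓡 n) x₀).source) :
    tangentCoord x₀ q = mfderiv (𝓡 n) 𝓘(ℝ, 𝔼) (extChartAt (𝓡 n) x₀) q.1 q.2 := by
  have hq' : q.1 ∈ (chartAt 𝔼 x₀).source := by rwa [← extChartAt_source (𝓡 n)]
  have hb : q.1 ∈ (tangentTriv x₀ : Bundle.Trivialization 𝔼
      (Bundle.TotalSpace.proj : TangentBundle (𝓡 n) Q → Q)).baseSet := by
    rwa [TangentBundle.trivializationAt_baseSet]
  have := congrFun ((tangentTriv x₀).continuousLinearMapAt_apply ℝ q.1) q.2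
  rw [Bundle.Trivialization.coe_linearMapAt_of_mem _ hb] at this
  refine this.symm.trans ?_
  exact congrArg (fun L => L q.2)
    (TangentBundle.continuousLinearMapAt_trivializationAt (I := 𝓡 n) (𝕜 := ℝ) hq')

/-- In the chart at `x₀`, the metric is `metricForm`. -/
theorem metricForm_tangentCoord (g : Metric n Q) {x₀ y : Q} (hy : y ∈ (extChartAt (𝓡 n) x₀).source)
    (v w : TangentSpace (𝓡 n) y) :
    metricForm g x₀ (extChartAt (𝓡 n) x₀ y) (tangentCoord x₀ ⟨y, v⟩) (tangentCoord x₀ ⟨y, w⟩) =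
      g.inner y v w := by
  have h := (extChartAt (𝓡 n) x₀).left_inv hy
  have hv := symmL_tangentCoord (q := ⟨y, v⟩) hy
  have hw := symmL_tangentCoord (q := ⟨y, w⟩) hy
  simp only at hv hw
  have key : ∀ y' : Q, y' = y → g.inner y' ((tangentTriv x₀).symmL ℝ y' (tangentCoord x₀ ⟨y, v⟩))
      ((tangentTriv x₀).symmL ℝ y' (tangentCoord x₀ ⟨y, w⟩)) = g.inner y v w := by
    rintro _ rfl
    rw [hv, hw]
  exact key _ h

theorem metricForm_symm (g : Metric n Q) (x₀ : Q) (u a b : 𝔼) :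
    metricForm g x₀ u a b = metricForm g x₀ u b a :=
  g.symm _ _ _

theorem metricForm_pos (g : Metric n Q) {x₀ : Q} {u : 𝔼}
    (hu : u ∈ (extChartAt (𝓡 n) x₀).target) {a : 𝔼} (ha : a ≠ 0) :
    0 < metricForm g x₀ u a a := by
  refine g.pos _ _ fun h => ha ?_
  have hy := (extChartAt (𝓡 n) x₀).map_target hu
  have e := congrArg (fun v => tangentCoord x₀
    (⟨(extChartAt (𝓡 n) x₀).symm u, v⟩ : TangentBundle (𝓡 n) Q)) 
    (h.trans (map_zero ((tangentTriv x₀).symmL ℝ ((extChartAt (𝓡 n) x₀).symm u))).symm)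
  exact (tangentCoord_symmL hy a).symm.trans (e.trans (tangentCoord_symmL hy 0))

/-- Sections with constant coordinates are smooth over the chart domain, and the coefficients of the
form are the smooth metric applied to two of them. -/
theorem contDiffOn_metricForm (g : Metric n Q) (x₀ : Q) :
    ContDiffOn ℝ ∞ (metricForm g x₀) (extChartAt (𝓡 n) x₀).target := by
  rw [contDiffOn_clm_apply]
  intro a
  rw [contDiffOn_clm_apply]
  intro b
  have hsec : ∀ a : 𝔼, ContMDiffOn (𝓡 n) ((𝓡 n).prod 𝓘(ℝ, 𝔼)) ∞
      (fun y : Q => (⟨y, (tangentTriv x₀).symmL ℝ y a⟩ : TangentBundle (𝓡 n) Q))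
      (extChartAt (𝓡 n) x₀).source := by
    intro a
    rw [extChartAt_source, ← TangentBundle.trivializationAt_baseSet (I := 𝓡 n)]
    rw [Bundle.Trivialization.contMDiffOn_section_baseSet_iff (tangentTriv x₀)]
    refine (contMDiffOn_const (c := a)).congr fun y hy => ?_
    rw [TangentBundle.trivializationAt_baseSet, ← extChartAt_source (𝓡 n)] at hy
    exact tangentCoord_symmL hy a
  have h2 : ContMDiffOn (𝓡 n) ((𝓡 n).prod 𝓘(ℝ)) ∞
      (fun y ↦ Bundle.TotalSpace.mk' ℝ (E := Bundle.Trivial Q ℝ) y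
        (g.inner y ((tangentTriv x₀).symmL ℝ y a) ((tangentTriv x₀).symmL ℝ y b)))
      (extChartAt (𝓡 n) x₀).source :=
    ContMDiffOn.clm_bundle_apply₂ (F₁ := 𝔼) (F₂ := 𝔼) g.contMDiff.contMDiffOn (hsec a) (hsec b)
  have h3 : ContMDiffOn (𝓡 n) 𝓘(ℝ) ∞
      (fun y ↦ (g.inner y ((tangentTriv x₀).symmL ℝ y a) ((tangentTriv x₀).symmL ℝ y b)))
      (extChartAt (𝓡 n) x₀).source := by
    intro y hy
    have := h2 y hy
    simp only [Bundle.contMDiffWithinAt_totalSpace] at this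
    exact this.2
  exact (h3.comp (contMDiffOn_extChartAt_symm x₀)
    (fun u hu => (extChartAt (𝓡 n) x₀).map_target hu)).contDiffOn

theorem contDiffAt_metricForm (g : Metric n Q) {x₀ : Q} {u : 𝔼}
    (hu : u ∈ (extChartAt (𝓡 n) x₀).target) : ContDiffAt ℝ ∞ (metricForm g x₀) u :=
  (contDiffOn_metricForm g x₀).contDiffAt ((isOpen_extChartAt_target x₀).mem_nhds hu)

theorem fderiv_metricInChart (g : Metric n Q) {x₀ : Q} {u : 𝔼}
    (hu : u ∈ (extChartAt (𝓡 n) x₀).target) (a b w : 𝔼) :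
    fderiv ℝ (fun y => metricInChart g x₀ y a b) u w = fderiv ℝ (metricForm g x₀) u w a b := by
  have h := ((contDiffAt_metricForm g hu).differentiableAt (by simp)).hasFDerivAt
  have h2 := (h.clm_apply (hasFDerivAt_const a u)).clm_apply (hasFDerivAt_const b u)
  have h3 := h2.fderiv
  simp only [metricForm_apply] at h3
  rw [h3]
  simp

/-- Positive definiteness and boundedness of the first derivatives, uniformly near a point. -/
theorem exists_metricForm_bounds (g : Metric n Q) {x₀ : Q} {u₀ : 𝔼}
    (hu : u₀ ∈ (extChartAt (𝓡 n) x₀).target) :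
    ∃ c C : ℝ, 0 < c ∧ 0 < C ∧ ∀ᶠ u in 𝓝 u₀, (∀ a, c * ‖a‖ ^ 2 ≤ metricForm g x₀ u a a) ∧
      ‖fderiv ℝ (metricForm g x₀) u‖ ≤ C := by
  have hcd := contDiffAt_metricForm g hu
  -- The factor 2 leaves room: at nearby points the form changes by less than `c` in norm, and the
  -- bound `c` survives.
  obtain ⟨c, hc, hc'⟩ : ∃ c : ℝ, 0 < c ∧ ∀ a, 2 * c * ‖a‖ ^ 2 ≤ metricForm g x₀ u₀ a a := by
    -- The minimum over the unit sphere gives the constant; for `n = 0` the sphere is empty and only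
    -- `a = 0` has to be treated.
    by_cases hne : (Metric.sphere (0 : 𝔼) 1).Nonempty
    · obtain ⟨b, hb, hmin⟩ := (isCompact_sphere (0 : 𝔼) 1).exists_isMinOn hne
        (f := fun a => metricForm g x₀ u₀ a a) (by fun_prop)
      have hb0 : b ≠ 0 := by
        rintro rfl
        simp at hb
      have hpos := metricForm_pos g hu hb0
      refine ⟨metricForm g x₀ u₀ b b / 2, by positivity, fun a => ?_⟩
      rcases eq_or_ne a 0 with rfl | ha
      · simp
      have hna : ‖a‖ ≠ 0 := norm_ne_zero_iff.2 ha
      have h1 : (‖a‖⁻¹ • a) ∈ Metric.sphere (0 : 𝔼) 1 := by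
        simp [norm_smul, hna]
      have h2 := hmin h1
      simp only [mem_ofPred_eq, map_smul, smul_apply, smul_eq_mul] at h2
      have h3 := mul_le_mul_of_nonneg_right h2 (sq_nonneg ‖a‖)
      have h4 : ‖a‖⁻¹ * (‖a‖⁻¹ * metricForm g x₀ u₀ a a) * ‖a‖ ^ 2 = metricForm g x₀ u₀ a a := by
        field_simp
      linarith
    · refine ⟨1, one_pos, fun a => ?_⟩
      have ha : a = 0 := by
        by_contra ha
        have hna : ‖a‖ ≠ 0 := norm_ne_zero_iff.2 ha
        exact hne ⟨‖a‖⁻¹ • a, by simp [norm_smul, hna]⟩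
      simp [ha]
  refine ⟨c, ‖fderiv ℝ (metricForm g x₀) u₀‖ + 1, hc, by positivity, ?_⟩
  have h1 : ∀ᶠ u in 𝓝 u₀, ‖metricForm g x₀ u - metricForm g x₀ u₀‖ < c := by
    have := hcd.continuousAt
    rw [Metric.continuousAt_iff'] at this
    simpa only [dist_eq_norm] using this c hc
  have h2 : ∀ᶠ u in 𝓝 u₀, ‖fderiv ℝ (metricForm g x₀) u‖ < ‖fderiv ℝ (metricForm g x₀) u₀‖ + 1 :=
    ((hcd.fderiv_right (m := 0) (by simp)).continuousAt.norm).eventually_lt_const (lt_add_one _)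
  filter_upwards [h1, h2] with u hu1 hu2
  refine ⟨fun a => ?_, hu2.le⟩
  have h3 : |(metricForm g x₀ u - metricForm g x₀ u₀) a a| ≤ c * ‖a‖ ^ 2 := by
    rw [← Real.norm_eq_abs]
    refine (ContinuousLinearMap.le_opNorm₂ _ a a).trans ?_
    rw [mul_assoc, ← sq]
    gcongr
  have h4 := (abs_le.1 h3).1
  simp only [sub_apply] at h4
  linarith [hc' a]

end Coordinates

/-! ### Geodesics as curves in charts -/

section Geodesics

variable {n : ℕ} {Q : Type*} [TopologicalSpace Q] [ChartedSpace (EuclideanSpace ℝ (Fin n)) Q]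
  [IsManifold (𝓡 n) ∞ Q]

local notation "𝔼" => EuclideanSpace ℝ (Fin n)

/-- The flow is defined by choosing a geodesic for each vector. Everything below uses only that some
geodesic with the right initial velocity was chosen. -/
theorem exists_geodesicFlow_eq {g : Metric n Q} (hg : IsComplete g) (q : TangentBundle (𝓡 n) Q) :
    ∃ γ : ℝ → Q, IsGeodesic g γ ∧ velocityLift γ 0 = q ∧
      ∀ t, geodesicFlow g t q = velocityLift γ t := by
  have h := hg q
  refine ⟨h.choose, h.choose_spec.1, h.choose_spec.2, fun t => ?_⟩
  rw [geodesicFlow, dif_pos h]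

theorem continuous_velocityLift {γ : ℝ → Q} (hγ : ContMDiff 𝓘(ℝ, ℝ) (𝓡 n) ∞ γ) :
    Continuous (velocityLift (n := n) γ) := by
  have h := hγ.continuous_tangentMap (by simp)
  have h2 : Continuous (fun t : ℝ => (⟨t, (1 : ℝ)⟩ : TangentBundle 𝓘(ℝ, ℝ) ℝ)) :=
    (tangentBundleModelSpaceHomeomorph 𝓘(ℝ, ℝ)).symm.continuous.comp
      (Continuous.prodMk continuous_id continuous_const : Continuous fun t : ℝ => (t, (1 : ℝ)))
  exact h.comp h2

theorem hasDerivAt_extChartAt_comp {γ : ℝ → Q} (hγ : ContMDiff 𝓘(ℝ, ℝ) (𝓡 n) ∞ γ) {x₀ : Q} {t : ℝ}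
    (ht : γ t ∈ (extChartAt (𝓡 n) x₀).source) :
    HasDerivAt (fun s => extChartAt (𝓡 n) x₀ (γ s)) (tangentCoord x₀ (velocityLift γ t)) t := by
  have hγ' := ((hγ t).mdifferentiableAt (by simp)).hasMFDerivAt
  have h1 := (mdifferentiableAt_extChartAt (I := 𝓡 n)
    (by rwa [← extChartAt_source (𝓡 n)] : γ t ∈ (chartAt 𝔼 x₀).source)).hasMFDerivAt
  obtain ⟨D, hD, hD1⟩ : ∃ D : ℝ →L[ℝ] 𝔼, HasFDerivAt (fun s => extChartAt (𝓡 n) x₀ (γ s)) D t ∧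
      D 1 = tangentCoord x₀ (velocityLift γ t) :=
    ⟨_, hasMFDerivAt_iff_hasFDerivAt.1 (h1.comp t hγ'), (tangentCoord_eq_mfderiv (q := velocityLift γ t) ht).symm⟩
  rw [← hD1]
  exact hD.hasDerivAt

theorem contDiffAt_extChartAt_comp {γ : ℝ → Q} (hγ : ContMDiff 𝓘(ℝ, ℝ) (𝓡 n) ∞ γ) {x₀ : Q} {t : ℝ}
    (ht : γ t ∈ (extChartAt (𝓡 n) x₀).source) :
    ContDiffAt ℝ ∞ (fun s => extChartAt (𝓡 n) x₀ (γ s)) t :=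
  ((contMDiffAt_extChartAt' (by rwa [← extChartAt_source (𝓡 n)])).comp t (hγ t)).contDiffAt

end Geodesics

/-! ### Energy conservation and uniform short-time estimates -/

section GeodesicEstimates

variable {n : ℕ} {Q : Type*} [TopologicalSpace Q] [ChartedSpace (EuclideanSpace ℝ (Fin n)) Q]
  [IsManifold (𝓡 n) ∞ Q]

local notation "𝔼" => EuclideanSpace ℝ (Fin n)

/-- With its converse `exists_tangentCoord_lt_imp_mem`, this describes neighborhoods of `q₀` by
norms of position and velocity coordinates, so that estimates along curves turn into statements
about neighborhoods. -/
theorem eventually_tangentCoord_lt (q₀ : TangentBundle (𝓡 n) Q) {δ : ℝ} (hδ : 0 < δ) :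
    ∀ᶠ q : TangentBundle (𝓡 n) Q in 𝓝 q₀, q.1 ∈ (extChartAt (𝓡 n) q₀.1).source ∧
      ‖extChartAt (𝓡 n) q₀.1 q.1 - extChartAt (𝓡 n) q₀.1 q₀.1‖ < δ ∧
      ‖tangentCoord q₀.1 q - tangentCoord q₀.1 q₀‖ < δ := by
  have hπ : ContinuousAt (fun q : TangentBundle (𝓡 n) Q => q.1) q₀ :=
    (FiberBundle.continuous_proj 𝔼 (fun x : Q => TangentSpace (𝓡 n) x)).continuousAt
  have hsrc : ∀ᶠ q : TangentBundle (𝓡 n) Q in 𝓝 q₀, q.1 ∈ (extChartAt (𝓡 n) q₀.1).source :=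
    hπ.eventually (extChartAt_source_mem_nhds q₀.1)
  have h1 : ContinuousAt (fun q : TangentBundle (𝓡 n) Q => extChartAt (𝓡 n) q₀.1 q.1) q₀ :=
    (continuousAt_extChartAt q₀.1).comp_of_eq hπ rfl
  have h2 : ContinuousAt (fun q : TangentBundle (𝓡 n) Q => tangentCoord q₀.1 q) q₀ := by
    have := (tangentTriv q₀.1).continuousOn.continuousAt ((tangentTriv q₀.1).open_source.mem_nhds
      (FiberBundle.mem_trivializationAt_proj_source (F := 𝔼) (x := q₀)))
    exact this.snd
  filter_upwards [hsrc, Metric.tendsto_nhds.1 h1 δ hδ, Metric.tendsto_nhds.1 h2 δ hδ]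
    with q ha hb hc
  exact ⟨ha, by rwa [← dist_eq_norm], by rwa [← dist_eq_norm]⟩

theorem exists_tangentCoord_lt_imp_mem (q₀ : TangentBundle (𝓡 n) Q)
    {N : Set (TangentBundle (𝓡 n) Q)} (hN : N ∈ 𝓝 q₀) :
    ∃ δ > 0, ∀ q : TangentBundle (𝓡 n) Q, q.1 ∈ (extChartAt (𝓡 n) q₀.1).source →
      ‖extChartAt (𝓡 n) q₀.1 q.1 - extChartAt (𝓡 n) q₀.1 q₀.1‖ < δ →
      ‖tangentCoord q₀.1 q - tangentCoord q₀.1 q₀‖ < δ → q ∈ N := by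
  have hmem : q₀ ∈ (tangentTriv q₀.1).source :=
    FiberBundle.mem_trivializationAt_proj_source (F := 𝔼) (x := q₀)
  have hc : ContinuousAt (fun p : 𝔼 × 𝔼 =>
      (tangentTriv q₀.1).toOpenPartialHomeomorph.symm ((extChartAt (𝓡 n) q₀.1).symm p.1, p.2))
      (extChartAt (𝓡 n) q₀.1 q₀.1, tangentCoord q₀.1 q₀) := by
    have h1 : ContinuousAt (fun p : 𝔼 × 𝔼 => ((extChartAt (𝓡 n) q₀.1).symm p.1, p.2))
        (extChartAt (𝓡 n) q₀.1 q₀.1, tangentCoord q₀.1 q₀) :=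
      ((continuousAt_extChartAt_symm (I := 𝓡 n) q₀.1).comp_of_eq continuousAt_fst rfl).prodMk
        continuousAt_snd
    refine ContinuousAt.comp_of_eq (y := tangentTriv q₀.1 q₀) ?_ h1 ?_
    · exact (tangentTriv q₀.1).toOpenPartialHomeomorph.continuousAt_symm
        ((tangentTriv q₀.1).toOpenPartialHomeomorph.map_source hmem)
    · rw [(extChartAt (𝓡 n) q₀.1).left_inv (mem_extChartAt_source q₀.1)]
      exact Prod.ext (TangentBundle.trivializationAt_fst q₀.1 q₀).symm rfl
  have hinv : ∀ q : TangentBundle (𝓡 n) Q, q.1 ∈ (extChartAt (𝓡 n) q₀.1).source →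
      (tangentTriv q₀.1).toOpenPartialHomeomorph.symm
        ((extChartAt (𝓡 n) q₀.1).symm (extChartAt (𝓡 n) q₀.1 q.1), tangentCoord q₀.1 q) = q := by
    intro q hq
    rw [(extChartAt (𝓡 n) q₀.1).left_inv hq]
    have hq' : q ∈ (tangentTriv q₀.1).source := by
      rw [Bundle.Trivialization.mem_source, TangentBundle.trivializationAt_baseSet,
        ← extChartAt_source (𝓡 n)]
      exact hq
    have := (tangentTriv q₀.1).toOpenPartialHomeomorph.left_inv hq'
    rw [← this]
    congr 1
    rw [this]
    exact Prod.ext (TangentBundle.trivializationAt_fst q₀.1 q).symm rfl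
  rw [ContinuousAt, hinv q₀ (mem_extChartAt_source q₀.1)] at hc
  obtain ⟨δ, hδ, h⟩ := Metric.eventually_nhds_iff.1 (hc hN)
  refine ⟨δ, hδ, fun q hq h1 h2 => ?_⟩
  have := h (y := (extChartAt (𝓡 n) q₀.1 q.1, tangentCoord q₀.1 q))
    (by rw [Prod.dist_eq, max_lt_iff, dist_eq_norm, dist_eq_norm]; exact ⟨h1, h2⟩)
  exact (hinv q hq) ▸ this

theorem hasDerivAt_tangentCoord_velocityLift {γ : ℝ → Q} (hγ : ContMDiff 𝓘(ℝ, ℝ) (𝓡 n) ∞ γ)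
    {x₀ : Q} {t : ℝ} (ht : γ t ∈ (extChartAt (𝓡 n) x₀).source) :
    deriv (fun s => extChartAt (𝓡 n) x₀ (γ s)) t = tangentCoord x₀ (velocityLift (n := n) γ t) ∧
    HasDerivAt (fun s => tangentCoord x₀ (velocityLift (n := n) γ s))
      (deriv (deriv (fun s => extChartAt (𝓡 n) x₀ (γ s))) t) t := by
  refine ⟨(hasDerivAt_extChartAt_comp hγ ht).deriv, ?_⟩
  have h1 : HasDerivAt (deriv (fun s => extChartAt (𝓡 n) x₀ (γ s)))
      (deriv (deriv (fun s => extChartAt (𝓡 n) x₀ (γ s))) t) t := by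
    have h2 := (contDiffAt_extChartAt_comp hγ ht).fderiv_right (m := 1)
      (by rw [one_add_one_eq_two]; exact ENat.LEInfty.out)
    exact ((h2.clm_apply contDiffAt_const).differentiableAt one_ne_zero).hasDerivAt
  refine h1.congr_of_eventuallyEq ?_
  filter_upwards [hγ.continuous.continuousAt.preimage_mem_nhds
    ((isOpen_extChartAt_source x₀).mem_nhds ht)] with s hs
  exact (hasDerivAt_extChartAt_comp hγ hs).deriv.symm

/-- The geodesic equation in terms of `metricForm`. -/
theorem IsGeodesic.metricForm_eq {g : Metric n Q} {γ : ℝ → Q} (hγ : IsGeodesic g γ)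
    {x₀ : Q} {t : ℝ} (ht : γ t ∈ (extChartAt (𝓡 n) x₀).source) (w : 𝔼) :
    let u := extChartAt (𝓡 n) x₀ (γ t)
    let a := tangentCoord x₀ (velocityLift (n := n) γ t)
    metricForm g x₀ u (deriv (deriv (fun s => extChartAt (𝓡 n) x₀ (γ s))) t) w
      + fderiv ℝ (metricForm g x₀) u a a w
      - (1 / 2) * fderiv ℝ (metricForm g x₀) u w a a = 0 := by
  intro u a
  have h := hγ.2 x₀ t ht w
  have hu := (extChartAt (𝓡 n) x₀).map_source ht
  simp only [fderiv_metricInChart g hu, (hasDerivAt_tangentCoord_velocityLift hγ.1 ht).1] at h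
  exact h

theorem hasDerivAt_bilinear_apply {E : Type*} [NormedAddCommGroup E] [NormedSpace ℝ E]
    {G : E → E →L[ℝ] E →L[ℝ] ℝ} {u a : ℝ → E} {u' a' : E} {t : ℝ}
    (hG : DifferentiableAt ℝ G (u t)) (hu : HasDerivAt u u' t) (ha : HasDerivAt a a' t) :
    HasDerivAt (fun s => G (u s) (a s) (a s))
      (fderiv ℝ G (u t) u' (a t) (a t) + G (u t) a' (a t) + G (u t) (a t) a') t := by
  have h := ((hG.hasFDerivAt.comp_hasDerivAt t hu).clm_apply ha).clm_apply ha
  simpa [add_apply] using h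

/-- Conservation of energy along geodesics. -/
theorem IsGeodesic.inner_velocityLift_eq {g : Metric n Q} {γ : ℝ → Q} (hγ : IsGeodesic g γ)
    (t : ℝ) :
    g.inner (γ t) (velocityLift (n := n) γ t).2 (velocityLift (n := n) γ t).2 =
      g.inner (γ 0) (velocityLift (n := n) γ 0).2 (velocityLift (n := n) γ 0).2 := by
  have key : ∀ t, HasDerivAt
      (fun s => g.inner (γ s) (velocityLift (n := n) γ s).2 (velocityLift (n := n) γ s).2) 0 t := by
    intro t
    have ht : γ t ∈ (extChartAt (𝓡 n) (γ t)).source := mem_extChartAt_source _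
    have hu := (extChartAt (𝓡 n) (γ t)).map_source ht
    have h1 := hasDerivAt_extChartAt_comp hγ.1 ht
    have h2 := (hasDerivAt_tangentCoord_velocityLift hγ.1 ht).2
    have h3 := hasDerivAt_bilinear_apply ((contDiffAt_metricForm g hu).differentiableAt (by simp))
      h1 h2
    -- Tested with the velocity itself, the two derivative terms combine to `1 - 1/2 = 1/2` of one
    -- term, and the geodesic equation becomes half the derivative of the energy.
    have heq := hγ.metricForm_eq ht (tangentCoord (γ t) (velocityLift (n := n) γ t))
    refine (h3.congr_of_eventuallyEq ?_).congr_deriv ?_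
    · filter_upwards [hγ.1.continuous.continuousAt.preimage_mem_nhds
        ((isOpen_extChartAt_source (γ t)).mem_nhds ht)] with s hs
      exact (metricForm_tangentCoord g (x₀ := γ t) hs _ _).symm
    · simp only at heq
      rw [metricForm_symm g _ _ (tangentCoord _ _)]
      linarith
  exact is_const_of_deriv_eq_zero (fun s => (key s).differentiableAt) (fun s => (key s).deriv) t 0

theorem geodesicFlow_mem_unitBundle {g : Metric n Q} (hg : IsComplete g)
    {q : TangentBundle (𝓡 n) Q} (hq : q ∈ unitBundle g) (t : ℝ) :
    geodesicFlow g t q ∈ unitBundle g := by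
  obtain ⟨γ, hγ, h0, h⟩ := exists_geodesicFlow_eq hg q
  rw [h t]
  have h1 := hγ.inner_velocityLift_eq t
  rw [← h0] at hq
  exact h1.trans hq

theorem geodesicFlow_zero {g : Metric n Q} (hg : IsComplete g) (q : TangentBundle (𝓡 n) Q) :
    geodesicFlow g 0 q = q := by
  obtain ⟨γ, hγ, h0, h⟩ := exists_geodesicFlow_eq hg q
  rw [h, h0]

theorem continuous_geodesicFlow {g : Metric n Q} (hg : IsComplete g) (q : TangentBundle (𝓡 n) Q) :
    Continuous fun t => geodesicFlow g t q := by
  obtain ⟨γ, hγ, h0, h⟩ := exists_geodesicFlow_eq hg q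
  simp_rw [h]
  exact continuous_velocityLift hγ.1

theorem continuous_geodesicFlow_fst {g : Metric n Q} (hg : IsComplete g)
    (q : TangentBundle (𝓡 n) Q) : Continuous fun t => (geodesicFlow g t q).1 :=
  (FiberBundle.continuous_proj 𝔼 (fun x : Q => TangentSpace (𝓡 n) x)).comp
    (continuous_geodesicFlow hg q)

/-- A curve whose speed in a chart is at most `K` as long as it stays in a ball stays in this ball
for a definite time. -/
theorem mem_ball_of_speed_le [T2Space Q] {x₀ : Q} {u₀ : 𝔼} {r K : ℝ} (hK : 0 < K)
    (hball : Metric.closedBall u₀ r ⊆ (extChartAt (𝓡 n) x₀).target) {γ : ℝ → Q}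
    (hγ : ContMDiff 𝓘(ℝ, ℝ) (𝓡 n) ∞ γ)
    (hspeed : ∀ t, γ t ∈ (extChartAt (𝓡 n) x₀).source →
      extChartAt (𝓡 n) x₀ (γ t) ∈ Metric.ball u₀ r →
      ‖tangentCoord x₀ (velocityLift (n := n) γ t)‖ ≤ K)
    (h0 : γ 0 ∈ (extChartAt (𝓡 n) x₀).source) {t : ℝ} (ht : 0 ≤ t)
    (hr : ‖extChartAt (𝓡 n) x₀ (γ 0) - u₀‖ + K * t < r) :
    γ t ∈ (extChartAt (𝓡 n) x₀).source ∧ ‖extChartAt (𝓡 n) x₀ (γ t) - u₀‖ ≤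
      ‖extChartAt (𝓡 n) x₀ (γ 0) - u₀‖ + K * t := by
  set φ := extChartAt (𝓡 n) x₀ with hφ
  set V : Set Q := φ.source ∩ φ ⁻¹' Metric.ball u₀ r with hV
  have hVo : IsOpen V :=
    (continuousOn_extChartAt x₀).isOpen_inter_preimage (isOpen_extChartAt_source x₀)
      Metric.isOpen_ball
  have hest : ∀ s, 0 ≤ s → (∀ s' ∈ Ico 0 s, γ s' ∈ V) → γ s ∈ φ.source →
      ‖φ (γ s) - u₀‖ ≤ ‖φ (γ 0) - u₀‖ + K * s := by
    intro s hs hin hsrc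
    have hin' : ∀ s' ∈ Icc 0 s, γ s' ∈ φ.source := by
      intro s' hs'
      rcases hs'.2.eq_or_lt with rfl | h
      · exact hsrc
      · exact (hin s' ⟨hs'.1, h⟩).1
    have := norm_image_sub_le_of_norm_deriv_le_segment' (f := fun s => φ (γ s)) (a := 0) (b := s)
      (f' := fun s => tangentCoord x₀ (velocityLift (n := n) γ s)) (C := K)
      (fun s' hs' => (hasDerivAt_extChartAt_comp hγ (hin' s' hs')).hasDerivWithinAt)
      (fun s' hs' => hspeed s' (hin s' hs').1 (hin s' hs').2) s ⟨hs, le_rfl⟩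
    calc ‖φ (γ s) - u₀‖ = ‖(φ (γ s) - φ (γ 0)) + (φ (γ 0) - u₀)‖ := by rw [sub_add_sub_cancel]
      _ ≤ ‖φ (γ s) - φ (γ 0)‖ + ‖φ (γ 0) - u₀‖ := norm_add_le _ _
      _ ≤ _ := by simp only [sub_zero] at this; linarith
  suffices hall : ∀ s ∈ Icc 0 t, γ s ∈ V from
    ⟨(hall t ⟨ht, le_rfl⟩).1, hest t ht (fun s hs => hall s ⟨hs.1, hs.2.le⟩)
      (hall t ⟨ht, le_rfl⟩).1⟩
  by_contra! hne
  obtain ⟨s₀, hs₀, hs₀V⟩ := hne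
  -- The infimum of `B` is the first exit time from `V`; it belongs to `B`, which is closed.
  set B : Set ℝ := Ici 0 ∩ γ ⁻¹' Vᶜ with hB
  have hBc : IsClosed B := isClosed_Ici.inter (hVo.isClosed_compl.preimage hγ.continuous)
  have hBb : BddBelow B := ⟨0, fun s hs => hs.1⟩
  have hBn : B.Nonempty := ⟨s₀, hs₀.1, hs₀V⟩
  have hmem := hBc.csInf_mem hBn hBb
  set s₁ := sInf B
  have hs₁t : s₁ ≤ t := (csInf_le hBb ⟨hs₀.1, hs₀V⟩).trans hs₀.2
  have hlt : ∀ s ∈ Ico 0 s₁, γ s ∈ V := by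
    intro s hs
    by_contra h
    exact absurd (csInf_le hBb (⟨hs.1, h⟩ : s ∈ B)) (not_le.2 hs.2)
  have h0V : γ 0 ∈ V := ⟨h0, by
    rw [mem_preimage, Metric.mem_ball, dist_eq_norm]
    have : 0 ≤ K * t := by positivity
    linarith⟩
  have hs₁pos : 0 < s₁ := by
    rcases (mem_Ici.1 hmem.1).eq_or_lt with h | h
    · exact absurd h0V (by rw [h]; exact hmem.2)
    · exact h
  set r₁ := ‖φ (γ 0) - u₀‖ + K * t
  -- Before the exit time the curve lies in the image of a strictly smaller closed ball. This image
  -- is compact, hence closed in the Hausdorff space `Q`, so the curve cannot leave the chart domain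
  -- at the exit time either.
  have hC : IsClosed (φ.symm '' Metric.closedBall u₀ r₁) :=
    ((isCompact_closedBall u₀ r₁).image_of_continuousOn ((continuousOn_extChartAt_symm x₀).mono
      ((Metric.closedBall_subset_closedBall hr.le).trans hball))).isClosed
  have hCV : φ.symm '' Metric.closedBall u₀ r₁ ⊆ V := by
    rintro _ ⟨u, hu, rfl⟩
    have hut := hball (Metric.closedBall_subset_closedBall hr.le hu)
    refine ⟨φ.map_target hut, ?_⟩
    rw [mem_preimage, φ.right_inv hut]
    exact lt_of_le_of_lt hu hr
  have hin : ∀ s ∈ Ico 0 s₁, γ s ∈ φ.symm '' Metric.closedBall u₀ r₁ := by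
    intro s hs
    refine ⟨φ (γ s), ?_, φ.left_inv (hlt s hs).1⟩
    rw [Metric.mem_closedBall, dist_eq_norm]
    refine (hest s hs.1 (fun s' hs' => hlt s' ⟨hs'.1, hs'.2.trans hs.2⟩) (hlt s hs).1).trans ?_
    have : K * s ≤ K * t := mul_le_mul_of_nonneg_left (hs.2.le.trans hs₁t) hK.le
    linarith
  have : γ s₁ ∈ φ.symm '' Metric.closedBall u₀ r₁ := by
    have hcl : s₁ ∈ closure (Ico 0 s₁) := by
      rw [closure_Ico hs₁pos.ne]
      exact ⟨hs₁pos.le, le_rfl⟩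
    exact hC.closure_subset_iff.2 (image_subset_iff.2 hin)
      (image_closure_subset_closure_image hγ.continuous ⟨s₁, hcl, rfl⟩)
  exact hmem.2 (hCV this)

/-- For a short time, unit speed geodesics that start near a given vector remain near it. -/
theorem exists_geodesicFlow_mem [T2Space Q] {g : Metric n Q} (hg : IsComplete g)
    {q₀ : TangentBundle (𝓡 n) Q} {N : Set (TangentBundle (𝓡 n) Q)} (hN : N ∈ 𝓝 q₀) :
    ∃ ε > 0, ∀ᶠ q in 𝓝 q₀, q ∈ unitBundle g → ∀ t ∈ Ico 0 ε, geodesicFlow g t q ∈ N := by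
  obtain ⟨δ, hδ, hδN⟩ := exists_tangentCoord_lt_imp_mem q₀ hN
  set x₀ := q₀.1
  set φ := extChartAt (𝓡 n) x₀
  set u₀ := φ x₀
  have hu₀ : u₀ ∈ φ.target := mem_extChartAt_target x₀
  obtain ⟨c, C, hc, hC, hbd⟩ := exists_metricForm_bounds g hu₀
  obtain ⟨r, hr, hrb⟩ := Metric.nhds_basis_closedBall.mem_iff.1
    (Filter.inter_mem ((isOpen_extChartAt_target x₀).mem_nhds hu₀) hbd)
  -- Speed bound: a unit vector with coordinates `a` satisfies `c ‖a‖² ≤ 1`.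
  set K := Real.sqrt (1 / c) with hKdef
  have hK : 0 < K := Real.sqrt_pos.2 (by positivity)
  have hK2 : K ^ 2 = 1 / c := Real.sq_sqrt (by positivity)
  -- Acceleration bound: the geodesic equation yields the constant `3 / 2`, rounded up to `2`.
  set A := 2 * C * K ^ 2 / c with hA
  have hApos : 0 < A := by positivity
  set η := min (δ / 2) (r / 2) with hη
  have hηpos : 0 < η := by positivity
  -- Within this time the position moves by less than `η` and the velocity by less than `δ / 2`; the
  -- other halves of `δ` and `r` are reserved for the distance of the initial vector from `q₀`.
  refine ⟨min (η / K) (δ / 2 / A), by positivity, ?_⟩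
  filter_upwards [eventually_tangentCoord_lt q₀ hηpos] with q hq hunit t ht
  obtain ⟨γ, hγ, h0, hflow⟩ := exists_geodesicFlow_eq hg q
  rw [hflow]
  have hγ0 : γ 0 = q.1 := congrArg (fun p => p.1) h0
  have hE : ∀ s, g.inner (γ s) (velocityLift (n := n) γ s).2 (velocityLift (n := n) γ s).2 = 1 := by
    intro s
    have h1 := hγ.inner_velocityLift_eq s
    rw [← h0] at hunit
    exact h1.trans hunit
  have hspeed : ∀ s, γ s ∈ φ.source → φ (γ s) ∈ Metric.ball u₀ r →
      ‖tangentCoord x₀ (velocityLift (n := n) γ s)‖ ≤ K := by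
    intro s hs hsr
    have h1 := (hrb (Metric.ball_subset_closedBall hsr)).2.1 (tangentCoord x₀ (velocityLift (n := n) γ s))
    have h2 := metricForm_tangentCoord g (x₀ := x₀) hs (velocityLift (n := n) γ s).2 (velocityLift (n := n) γ s).2
    rw [hE s] at h2
    refine Real.le_sqrt_of_sq_le ?_
    rw [le_div_iff₀ hc, mul_comm]
    exact h1.trans h2.le
  have hKη : ∀ s ∈ Icc 0 t, K * s < η := by
    intro s hs
    have := (hs.2.trans_lt ht.2).trans_le (min_le_left _ _)
    rw [lt_div_iff₀ hK] at this
    linarith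
  have hstart : ‖φ (γ 0) - u₀‖ < η := by rw [hγ0]; exact hq.2.1
  have hpos : ∀ s ∈ Icc 0 t, γ s ∈ φ.source ∧ ‖φ (γ s) - u₀‖ ≤ ‖φ (γ 0) - u₀‖ + K * s := by
    intro s hs
    refine mem_ball_of_speed_le hK (fun u hu => (hrb hu).1) hγ.1 hspeed ?_ hs.1 ?_
    · rw [hγ0]; exact hq.1
    · have := hKη s hs
      have : η ≤ r / 2 := min_le_right _ _
      linarith
  have hball : ∀ s ∈ Icc 0 t, φ (γ s) ∈ Metric.ball u₀ r := by
    intro s hs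
    have h1 := hKη s hs
    have h2 : η ≤ r / 2 := min_le_right _ _
    rw [Metric.mem_ball, dist_eq_norm]
    linarith [(hpos s hs).2]
  have hacc : ∀ s ∈ Icc 0 t, ‖deriv (deriv (fun s => φ (γ s))) s‖ ≤ A := by
    intro s hs
    set w := deriv (deriv (fun s => φ (γ s))) s
    set a := tangentCoord x₀ (velocityLift (n := n) γ s)
    have ha : ‖a‖ ≤ K := hspeed s (hpos s hs).1 (hball s hs)
    obtain ⟨-, hpd, hD⟩ := hrb (Metric.ball_subset_closedBall (hball s hs))
    -- Tested with the acceleration `w` itself, the equation bounds `c ‖w‖²` by a multiple of `C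
    -- ‖a‖² ‖w‖`.
    have heq := hγ.metricForm_eq (hpos s hs).1 w
    have hb : ∀ b b' b'', |fderiv ℝ (metricForm g x₀) (φ (γ s)) b b' b''| ≤
        C * ‖b‖ * ‖b'‖ * ‖b''‖ := by
      intro b b' b''
      rw [← Real.norm_eq_abs]
      calc _ ≤ ‖fderiv ℝ (metricForm g x₀) (φ (γ s)) b‖ * ‖b'‖ * ‖b''‖ :=
            ContinuousLinearMap.le_opNorm₂ _ _ _
        _ ≤ ‖fderiv ℝ (metricForm g x₀) (φ (γ s))‖ * ‖b‖ * ‖b'‖ * ‖b''‖ := by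
            gcongr
            exact ContinuousLinearMap.le_opNorm _ _
        _ ≤ _ := by gcongr
    have h1 := (abs_le.1 (hb a a w)).1
    have h2 := (abs_le.1 (hb w a a)).2
    have h3 := hpd w
    have h4 : c * ‖w‖ ^ 2 ≤ 3 / 2 * (C * ‖a‖ ^ 2 * ‖w‖) := by
      simp only at heq
      nlinarith
    have h5 : C * ‖a‖ ^ 2 * ‖w‖ ≤ C * K ^ 2 * ‖w‖ := by gcongr
    rcases (norm_nonneg w).eq_or_lt with h | h
    · rw [← h]; exact hApos.le
    · rw [hA, le_div_iff₀ hc]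
      have h6 : c * ‖w‖ ^ 2 ≤ 2 * (C * K ^ 2 * ‖w‖) := by
        have : 0 ≤ C * K ^ 2 * ‖w‖ := by positivity
        linarith
      have h7 : (‖w‖ * c) * ‖w‖ ≤ (2 * C * K ^ 2) * ‖w‖ := by nlinarith
      exact le_of_mul_le_mul_right h7 h
  have hvel := norm_image_sub_le_of_norm_deriv_le_segment'
    (f := fun s => tangentCoord x₀ (velocityLift (n := n) γ s)) (a := 0) (b := t) (C := A)
    (fun s hs => (hasDerivAt_tangentCoord_velocityLift hγ.1 (hpos s hs).1).2.hasDerivWithinAt)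
    (fun s hs => hacc s ⟨hs.1, hs.2.le⟩) t ⟨ht.1, le_rfl⟩
  have htt : t ∈ Icc 0 t := ⟨ht.1, le_rfl⟩
  have hηδ : η ≤ δ / 2 := min_le_left _ _
  refine hδN _ (hpos t htt).1 ?_ ?_
  · have h1 := (hpos t htt).2
    have h2 := hKη t htt
    have h3 : (velocityLift (n := n) γ t).1 = γ t := rfl
    rw [h3]
    linarith
  · have h1 : A * t < δ / 2 := by
      have := ht.2.trans_le (min_le_right _ _)
      rw [lt_div_iff₀ hApos] at this
      linarith
    have h2 : tangentCoord x₀ (velocityLift (n := n) γ 0) = tangentCoord x₀ q := by rw [h0]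
    simp only [sub_zero, h2] at hvel
    calc ‖tangentCoord x₀ (velocityLift (n := n) γ t) - tangentCoord x₀ q₀‖
        = ‖(tangentCoord x₀ (velocityLift (n := n) γ t) - tangentCoord x₀ q) +
            (tangentCoord x₀ q - tangentCoord x₀ q₀)‖ := by rw [sub_add_sub_cancel]
      _ ≤ _ := norm_add_le _ _
      _ < δ := by linarith [hq.2.2]

end GeodesicEstimates

/-! ### Defining functions, unit normals and reflection -/

section Normals

variable {n : ℕ} {Q : Type*} [TopologicalSpace Q] [ChartedSpace (EuclideanSpace ℝ (Fin n)) Q]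
  [IsManifold (𝓡 n) ∞ Q]

local notation "𝔼" => EuclideanSpace ℝ (Fin n)

theorem tendsto_of_tangentCoord {α : Type*} {l : Filter α} {f : α → TangentBundle (𝓡 n) Q}
    {q₀ : TangentBundle (𝓡 n) Q} (h1 : Filter.Tendsto (fun a => (f a).1) l (𝓝 q₀.1))
    (h2 : Filter.Tendsto (fun a => tangentCoord q₀.1 (f a)) l (𝓝 (tangentCoord q₀.1 q₀))) :
    Filter.Tendsto f l (𝓝 q₀) := by
  intro N hN
  obtain ⟨δ, hδ, hN'⟩ := exists_tangentCoord_lt_imp_mem q₀ hN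
  have h3 := Metric.tendsto_nhds.1 ((continuousAt_extChartAt (I := 𝓡 n) q₀.1).tendsto.comp h1) δ hδ
  have h4 := h1.eventually (extChartAt_source_mem_nhds (I := 𝓡 n) q₀.1)
  change ∀ᶠ a in l, f a ∈ N
  filter_upwards [h4, h3, Metric.tendsto_nhds.1 h2 δ hδ] with a ha hb hc
  exact hN' _ ha (by rw [← dist_eq_norm]; exact hb) (by rw [← dist_eq_norm]; exact hc)

theorem continuousAt_tangentCoord (q₀ : TangentBundle (𝓡 n) Q) :
    ContinuousAt (tangentCoord q₀.1) q₀ := by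
  rw [Metric.continuousAt_iff']
  intro δ hδ
  filter_upwards [eventually_tangentCoord_lt q₀ hδ] with q hq
  rw [dist_eq_norm]
  exact hq.2.2

theorem continuous_base : Continuous (fun q : TangentBundle (𝓡 n) Q => q.1) :=
  FiberBundle.continuous_proj 𝔼 (fun x : Q => TangentSpace (𝓡 n) x)

theorem tangentCoord_add_smul {x₀ y : Q} (hy : y ∈ (extChartAt (𝓡 n) x₀).source)
    (v w : TangentSpace (𝓡 n) y) (c : ℝ) :
    tangentCoord x₀ (⟨y, v + c • w⟩ : TangentBundle (𝓡 n) Q) =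
      tangentCoord x₀ (⟨y, v⟩ : TangentBundle (𝓡 n) Q) +
        c • tangentCoord x₀ (⟨y, w⟩ : TangentBundle (𝓡 n) Q) := by
  rw [tangentCoord_eq_mfderiv (q := ⟨y, v + c • w⟩) hy, tangentCoord_eq_mfderiv (q := ⟨y, v⟩) hy,
    tangentCoord_eq_mfderiv (q := ⟨y, w⟩) hy]
  exact (map_add (mfderiv (𝓡 n) 𝓘(ℝ, 𝔼) (extChartAt (𝓡 n) x₀) y) v (c • w)).trans
    (congrArg _ (map_smul (mfderiv (𝓡 n) 𝓘(ℝ, 𝔼) (extChartAt (𝓡 n) x₀) y) c w))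

/-- Moves differentials at varying points `y` into the fixed vector space of the chart at `x₀`,
where their continuity in `y` makes sense. -/
theorem mfderiv_apply_eq_fderiv {ρ : Q → ℝ} {x₀ y : Q} (hy : y ∈ (extChartAt (𝓡 n) x₀).source)
    (hρ : MDifferentiableAt (𝓡 n) 𝓘(ℝ, ℝ) ρ y) (v : TangentSpace (𝓡 n) y) :
    (mfderiv (𝓡 n) 𝓘(ℝ, ℝ) ρ y v : ℝ) =
      fderiv ℝ (ρ ∘ (extChartAt (𝓡 n) x₀).symm) (extChartAt (𝓡 n) x₀ y)
        (tangentCoord x₀ ⟨y, v⟩) := by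
  have hy' : y ∈ (chartAt 𝔼 x₀).source := by rwa [← extChartAt_source (𝓡 n)]
  have ht := (extChartAt (𝓡 n) x₀).map_source hy
  have h1 : MDifferentiableAt 𝓘(ℝ, 𝔼) (𝓡 n) (extChartAt (𝓡 n) x₀).symm (extChartAt (𝓡 n) x₀ y) :=
    ((contMDiffOn_extChartAt_symm (n := ∞) x₀).contMDiffAt
      ((isOpen_extChartAt_target x₀).mem_nhds ht)).mdifferentiableAt (by simp)
  have h2 : MDifferentiableAt 𝓘(ℝ, 𝔼) 𝓘(ℝ, ℝ) (ρ ∘ (extChartAt (𝓡 n) x₀).symm)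
      (extChartAt (𝓡 n) x₀ y) :=
    MDifferentiableAt.comp _ (by rwa [(extChartAt (𝓡 n) x₀).left_inv hy]) h1
  have h3 := mdifferentiableAt_extChartAt (I := 𝓡 n) hy'
  have h4 := (h2.hasMFDerivAt.comp y h3.hasMFDerivAt).congr_of_eventuallyEq (f₁ := ρ) (by
    filter_upwards [(isOpen_extChartAt_source (I := 𝓡 n) x₀).mem_nhds hy] with z hz
    simp only [Function.comp_apply, (extChartAt (𝓡 n) x₀).left_inv hz])
  rw [h4.mfderiv, tangentCoord_eq_mfderiv (q := ⟨y, v⟩) hy, mfderiv_eq_fderiv]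
  rfl

theorem IsLocalDefiningFunction.mdifferentiableAt {Ω : Set Q} {x : Q} {ρ : Q → ℝ}
    (h : IsLocalDefiningFunction (n := n) Ω x ρ) : MDifferentiableAt (𝓡 n) 𝓘(ℝ, ℝ) ρ x := by
  obtain ⟨-, -, U, hU, hx, hs, -⟩ := h
  exact (hs.contMDiffAt (hU.mem_nhds hx)).mdifferentiableAt (by simp)

/-- The differential of a local defining function in the chart at the point does not vanish. -/
theorem IsLocalDefiningFunction.fderiv_ne_zero {Ω : Set Q} {x : Q} {ρ : Q → ℝ}
    (h : IsLocalDefiningFunction (n := n) Ω x ρ) :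
    fderiv ℝ (ρ ∘ (extChartAt (𝓡 n) x).symm) (extChartAt (𝓡 n) x x) ≠ 0 := by
  intro h0
  refine h.2.1 ?_
  ext v
  have := mfderiv_apply_eq_fderiv (mem_extChartAt_source x) h.mdifferentiableAt v
  rw [h0] at this
  exact this

theorem contDiffAt_comp_extChartAt_symm {ρ : Q → ℝ} {x : Q} {U : Set Q} (hU : IsOpen U)
    (hx : x ∈ U) (hs : ContMDiffOn (𝓡 n) 𝓘(ℝ, ℝ) ∞ ρ U) :
    ContDiffAt ℝ ∞ (ρ ∘ (extChartAt (𝓡 n) x).symm) (extChartAt (𝓡 n) x x) := by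
  have h1 := (contMDiffOn_extChartAt_symm (I := 𝓡 n) (n := ∞) x).contMDiffAt
      ((isOpen_extChartAt_target x).mem_nhds (mem_extChartAt_target x))
  have h2 := hs.contMDiffAt (hU.mem_nhds hx)
  exact (ContMDiffAt.comp_of_eq h2 h1 (extChartAt_to_inv x)).contDiffAt

/-- A local defining function at `x` vanishes at all nearby boundary points. -/
theorem eq_zero_of_mem_frontier {Ω : Set Q} (hΩ : IsClosed Ω) {ρ : Q → ℝ} {U : Set Q}
    (hU : IsOpen U) (hs : ContMDiffOn (𝓡 n) 𝓘(ℝ, ℝ) ∞ ρ U) (hΩU : ∀ y ∈ U, (y ∈ Ω ↔ ρ y ≤ 0))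
    {y : Q} (hyU : y ∈ U) (hy : y ∈ frontier Ω) : ρ y = 0 := by
  refine le_antisymm ((hΩU y hyU).1 (hΩ.frontier_subset hy)) (not_lt.1 fun hlt => ?_)
  refine hy.2 (mem_interior_iff_mem_nhds.2 ?_)
  filter_upwards [hU.mem_nhds hyU, (hs.continuousOn.continuousAt (hU.mem_nhds hyU)).eventually
    (gt_mem_nhds hlt)] with z hz hz'
  exact (hΩU z hz).2 hz'.le

/-- A local defining function at `x` is one at all nearby boundary points. -/
theorem IsLocalDefiningFunction.eventually {Ω : Set Q} (hΩ : IsClosed Ω) {x : Q} {ρ : Q → ℝ}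
    (h : IsLocalDefiningFunction (n := n) Ω x ρ) :
    ∀ᶠ y in 𝓝 x, MDifferentiableAt (𝓡 n) 𝓘(ℝ, ℝ) ρ y ∧ y ∈ (extChartAt (𝓡 n) x).source ∧
      fderiv ℝ (ρ ∘ (extChartAt (𝓡 n) x).symm) (extChartAt (𝓡 n) x y) ≠ 0 ∧
      (y ∈ Ω ↔ ρ y ≤ 0) ∧
      (y ∈ frontier Ω → ρ y = 0 ∧ IsLocalDefiningFunction (n := n) Ω y ρ) := by
  obtain ⟨-, -, U, hU, hx, hs, hΩU⟩ := id h
  have h1 := ((contDiffAt_comp_extChartAt_symm hU hx hs).fderiv_right (m := 0)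
    (by simp)).continuousAt
  have h2 := (h1.comp (continuousAt_extChartAt (I := 𝓡 n) x)).eventually_ne h.fderiv_ne_zero
  filter_upwards [hU.mem_nhds hx, extChartAt_source_mem_nhds (I := 𝓡 n) x, h2] with y hyU hy hne
  have hmd : MDifferentiableAt (𝓡 n) 𝓘(ℝ, ℝ) ρ y :=
    (hs.contMDiffAt (hU.mem_nhds hyU)).mdifferentiableAt (by simp)
  refine ⟨hmd, hy, hne, hΩU y hyU, fun hf => ?_⟩
  have h0 := eq_zero_of_mem_frontier hΩ hU hs hΩU hyU hf
  refine ⟨h0, h0, fun hd => hne ?_, U, hU, hyU, hs, hΩU⟩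
  ext a
  have := mfderiv_apply_eq_fderiv hy hmd ((tangentTriv x).symmL ℝ y a)
  rw [tangentCoord_symmL hy] at this
  rw [Function.comp_apply, ← this, hd]
  rfl

theorem eventually_pos_of_hasDerivAt_pos {f : ℝ → ℝ} {f' : ℝ} (h : HasDerivAt f f' 0)
    (h0 : f 0 = 0) (hf' : 0 < f') : ∀ᶠ t in 𝓝[>] 0, 0 < f t := by
  have := eventually_nhdsWithin_sign_eq_of_deriv_pos (by rwa [h.deriv]) h0
  filter_upwards [nhdsWithin_le_nhds this, self_mem_nhdsWithin] with t ht ht0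
  rw [sub_zero, sign_pos (mem_Ioi.1 ht0)] at ht
  exact sign_eq_one_iff.1 ht

/-- Start from `w` with `l₁ w = -1`. If `l₂` did not vanish on the kernel of `l₁`, adding a kernel
vector would raise `l₂` to 1 without changing `l₁`. Hence `l₂` is a multiple of `l₁`, and its value
at `w` decides the sign. -/
theorem exists_smul_of_halfspace_le {E : Type*} [AddCommGroup E] [Module ℝ E] {l₁ l₂ : E →ₗ[ℝ] ℝ}
    (h₁ : l₁ ≠ 0) (h₂ : l₂ ≠ 0) (h : ∀ w, l₁ w < 0 → l₂ w ≤ 0) :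
    ∃ c : ℝ, 0 < c ∧ ∀ w, l₂ w = c * l₁ w := by
  obtain ⟨w, hw⟩ : ∃ w, l₁ w = -1 := by
    obtain ⟨v, hv⟩ := DFunLike.ne_iff.1 h₁
    simp only [LinearMap.zero_apply] at hv
    exact ⟨(-(l₁ v)⁻¹) • v, by simp [hv]⟩
  have hker : ∀ z, l₁ z = 0 → l₂ z = 0 := by
    intro z hz
    by_contra hne
    have := h (w + ((1 - l₂ w) / l₂ z) • z) (by simp [hz, hw])
    simp only [map_add, map_smul, smul_eq_mul, div_mul_cancel₀ _ hne] at this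
    linarith
  have heq : ∀ v, l₂ v = -l₂ w * l₁ v := by
    intro v
    have := hker (v + l₁ v • w) (by simp [hw])
    simp only [map_add, map_smul, smul_eq_mul] at this
    linarith
  refine ⟨-l₂ w, ?_, heq⟩
  have h1 := h w (by rw [hw]; norm_num)
  rcases h1.lt_or_eq with h2 | h2
  · linarith
  · exact absurd (LinearMap.ext fun v => by simp [heq v, h2]) h₂

/-- The differentials of two local defining functions are positively proportional. -/
theorem IsLocalDefiningFunction.exists_mfderiv_eq {Ω : Set Q} {x : Q} {ρ₁ ρ₂ : Q → ℝ}
    (h₁ : IsLocalDefiningFunction (n := n) Ω x ρ₁) (h₂ : IsLocalDefiningFunction (n := n) Ω x ρ₂) :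
    ∃ c : ℝ, 0 < c ∧ ∀ w : 𝔼,
      fderiv ℝ (ρ₂ ∘ (extChartAt (𝓡 n) x).symm) (extChartAt (𝓡 n) x x) w =
        c * fderiv ℝ (ρ₁ ∘ (extChartAt (𝓡 n) x).symm) (extChartAt (𝓡 n) x x) w := by
  set u := extChartAt (𝓡 n) x x with hu
  refine exists_smul_of_halfspace_le
    (l₁ := (fderiv ℝ (ρ₁ ∘ (extChartAt (𝓡 n) x).symm) u).toLinearMap)
    (l₂ := (fderiv ℝ (ρ₂ ∘ (extChartAt (𝓡 n) x).symm) u).toLinearMap)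
    (fun h => h₁.fderiv_ne_zero (ContinuousLinearMap.coe_injective h))
    (fun h => h₂.fderiv_ne_zero (ContinuousLinearMap.coe_injective h)) fun w hw => ?_
  simp only [ContinuousLinearMap.coe_coe] at hw ⊢
  -- Otherwise the ray `u + t w` would, for small `t > 0`, have `ρ₁ < 0 < ρ₂`, although both
  -- functions describe the same set `Ω`.
  by_contra! hw2
  obtain ⟨h1, -, U₁, hU₁, hx₁, hs₁, hΩ₁⟩ := h₁
  obtain ⟨h2, -, U₂, hU₂, hx₂, hs₂, hΩ₂⟩ := h₂
  have hline : HasDerivAt (fun t : ℝ => u + t • w) w 0 := by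
    simpa using ((hasDerivAt_id (0 : ℝ)).smul_const w).const_add u
  have hline0 : (fun t : ℝ => u + t • w) 0 = u := by simp
  have hd : ∀ {ρ : Q → ℝ} {U : Set Q}, IsOpen U → x ∈ U → ContMDiffOn (𝓡 n) 𝓘(ℝ, ℝ) ∞ ρ U →
      HasDerivAt (fun t : ℝ => ρ ((extChartAt (𝓡 n) x).symm (u + t • w)))
        (fderiv ℝ (ρ ∘ (extChartAt (𝓡 n) x).symm) u w) 0 := by
    intro ρ U hU hx hs
    have := ((contDiffAt_comp_extChartAt_symm hU hx hs).differentiableAt (by simp)).hasFDerivAt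
    rw [← hu] at this
    exact HasFDerivAt.comp_hasDerivAt_of_eq (0 : ℝ) this hline hline0.symm
  have e1 := eventually_pos_of_hasDerivAt_pos (hd hU₁ hx₁ hs₁).neg (by simp [hu, h1])
    (neg_pos.2 hw)
  have e2 := eventually_pos_of_hasDerivAt_pos (hd hU₂ hx₂ hs₂) (by simp [hu, h2]) hw2
  have hcont : ContinuousAt (fun t : ℝ => (extChartAt (𝓡 n) x).symm (u + t • w)) 0 :=
    ContinuousAt.comp_of_eq (continuousAt_extChartAt_symm (I := 𝓡 n) x) hline.continuousAt hline0
  have hx0 : (fun t : ℝ => (extChartAt (𝓡 n) x).symm (u + t • w)) 0 = x := by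
    simp [hu]
  have e3 := hcont.eventually ((hU₁.inter hU₂).mem_nhds (hx0.symm ▸ ⟨hx₁, hx₂⟩))
  obtain ⟨t, ⟨ht1, ht2⟩, ht3⟩ := ((e1.and e2).and (nhdsWithin_le_nhds e3)).exists
  simp only [Pi.neg_apply, Left.neg_pos_iff] at ht1
  have := (hΩ₂ _ ht3.2).1 ((hΩ₁ _ ht3.1).2 ht1.le)
  linarith

theorem metricForm_injective (g : Metric n Q) {x₀ : Q} {u : 𝔼}
    (hu : u ∈ (extChartAt (𝓡 n) x₀).target) : Function.Injective (metricForm g x₀ u) := by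
  intro a b hab
  by_contra hne
  have h0 : metricForm g x₀ u (a - b) = 0 := by rw [map_sub, hab, sub_self]
  have := metricForm_pos g hu (sub_ne_zero.2 hne)
  simp [h0] at this

/-- The metric in a chart as an isomorphism from vectors to covectors. -/
theorem exists_equiv_metricForm (g : Metric n Q) {x₀ : Q} {u : 𝔼}
    (hu : u ∈ (extChartAt (𝓡 n) x₀).target) :
    ∃ e : 𝔼 ≃L[ℝ] (𝔼 →L[ℝ] ℝ), (e : 𝔼 →L[ℝ] (𝔼 →L[ℝ] ℝ)) = metricForm g x₀ u := by
  have hfr : Module.finrank ℝ 𝔼 = Module.finrank ℝ (𝔼 →L[ℝ] ℝ) := by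
    rw [← (LinearMap.toContinuousLinearMap : (𝔼 →ₗ[ℝ] ℝ) ≃ₗ[ℝ] _).finrank_eq]
    exact Subspace.dual_finrank_eq.symm
  have hinj := metricForm_injective g hu
  refine ⟨(LinearEquiv.ofInjectiveOfFinrankEq (metricForm g x₀ u).toLinearMap hinj
    hfr).toContinuousLinearEquiv, ?_⟩
  ext a b
  rfl

/-- Proportional differentials give proportional normals with a factor `d > 0`; unit length forces
`d * d = 1`. The normal picked by choice in `inwardNormal` is thus canonical. -/
theorem IsInwardUnitNormal.unique {g : Metric n Q} {Ω : Set Q} {x : Q}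
    {ν₁ ν₂ : TangentSpace (𝓡 n) x} (h₁ : IsInwardUnitNormal g Ω x ν₁)
    (h₂ : IsInwardUnitNormal g Ω x ν₂) : ν₁ = ν₂ := by
  obtain ⟨hu₁, ρ₁, hρ₁, c₁, hc₁, hν₁⟩ := h₁
  obtain ⟨hu₂, ρ₂, hρ₂, c₂, hc₂, hν₂⟩ := h₂
  obtain ⟨c, hc, hcw⟩ := hρ₁.exists_mfderiv_eq hρ₂
  have hprop : ∀ w : TangentSpace (𝓡 n) x, g.inner x ν₂ w = c * c₁ / c₂ * g.inner x ν₁ w := by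
    intro w
    have h1 := hν₁ w
    have h2 := hν₂ w
    have hsrc := mem_extChartAt_source (I := 𝓡 n) x
    rw [mfderiv_apply_eq_fderiv hsrc hρ₁.mdifferentiableAt] at h1
    rw [mfderiv_apply_eq_fderiv hsrc hρ₂.mdifferentiableAt, hcw, h1] at h2
    have key : ∀ A B : ℝ, c * (-c₁ * A) = -c₂ * B → B = c * c₁ / c₂ * A := by
      intro A B h
      field_simp
      linarith
    exact key _ _ h2
  set d := c * c₁ / c₂ with hd
  have hdpos : 0 < d := by positivity
  have e1 := hprop ν₁
  have e2 := hprop ν₂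
  rw [hu₁, g.symm, mul_one] at e1
  rw [hu₂, e1] at e2
  have hd1 : d = 1 := by nlinarith
  rw [hd1] at hprop
  by_contra hne
  have h3 := g.pos x (ν₁ - ν₂) (sub_ne_zero.2 hne)
  have h4 := hprop (ν₁ - ν₂)
  rw [map_sub (g.inner x) ν₁ ν₂, sub_apply] at h3
  linarith

theorem inwardNormal_eq {g : Metric n Q} {Ω : Set Q} {x : Q} {ν : TangentSpace (𝓡 n) x}
    (h : IsInwardUnitNormal g Ω x ν) : inwardNormal g Ω x = ν := by
  have hex : ∃ ν, IsInwardUnitNormal g Ω x ν := ⟨ν, h⟩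
  rw [inwardNormal, dif_pos hex]
  exact hex.choose_spec.unique h

/-- Near a boundary point the inward unit normals are the values of a continuous vector field. -/
theorem exists_continuousAt_inwardNormal (g : Metric n Q) {Ω : Set Q} (hΩ : IsObstacle n Ω)
    {x : Q} (hx : x ∈ frontier Ω) :
    ∃ ν : Q → 𝔼, ContinuousAt ν x ∧ ∀ᶠ y in 𝓝 x, y ∈ frontier Ω →
      IsInwardUnitNormal g Ω y (inwardNormal g Ω y) ∧
        tangentCoord x ⟨y, inwardNormal g Ω y⟩ = ν y := by
  obtain ⟨ρ, hρ⟩ := hΩ.2 x hx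
  set φ := extChartAt (𝓡 n) x
  set D : Q → 𝔼 →L[ℝ] ℝ := fun y => fderiv ℝ (ρ ∘ φ.symm) (φ y)
  set a : Q → 𝔼 := fun y => (metricForm g x (φ y)).inverse (D y)
  have hφ : ContinuousAt φ x := continuousAt_extChartAt (I := 𝓡 n) x
  have hDc : ContinuousAt D x := by
    obtain ⟨-, -, U, hU, hxU, hs, -⟩ := id hρ
    exact ((contDiffAt_comp_extChartAt_symm hU hxU hs).fderiv_right (m := 0)
      (by simp)).continuousAt.comp hφ
  have hGc : ContinuousAt (fun y => metricForm g x (φ y)) x :=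
    (contDiffAt_metricForm g (mem_extChartAt_target x)).continuousAt.comp hφ
  have hinvc : ContinuousAt (fun y => (metricForm g x (φ y)).inverse) x := by
    obtain ⟨e, he⟩ := exists_equiv_metricForm g (mem_extChartAt_target (I := 𝓡 n) x)
    have := (contDiffAt_map_inverse (n := 0) e).continuousAt
    rw [he] at this
    exact ContinuousAt.comp_of_eq this hGc rfl
  have hac : ContinuousAt a x := hinvc.clm_apply hDc
  have hspec : ∀ y ∈ φ.source, metricForm g x (φ y) (a y) = D y := by
    intro y hy
    obtain ⟨e, he⟩ := exists_equiv_metricForm g (φ.map_source hy)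
    simp only [a, ← he, ContinuousLinearMap.inverse_equiv]
    exact e.apply_symm_apply _
  have hpos : ∀ y ∈ φ.source, D y ≠ 0 → 0 < D y (a y) := by
    intro y hy hne
    rw [← hspec y hy]
    refine metricForm_pos g (φ.map_source hy) fun h0 => hne ?_
    rw [← hspec y hy, h0, map_zero]
  have hDa : ContinuousAt (fun y => D y (a y)) x := hDc.clm_apply hac
  -- `D y (a y)` is the squared length of the gradient. The minus sign appears because `Ω = {ρ ≤
  -- 0}`, so the gradient points out of `Ω`.
  refine ⟨fun y => -(Real.sqrt (D y (a y)))⁻¹ • a y, ?_, ?_⟩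
  · have hne : Real.sqrt (D x (a x)) ≠ 0 :=
      (Real.sqrt_pos.2 (hpos x (mem_extChartAt_source x) hρ.fderiv_ne_zero)).ne'
    exact ((hDa.sqrt.inv₀ hne).neg).smul hac
  filter_upwards [hρ.eventually hΩ.1] with y hy hyf
  obtain ⟨hmd, hsrc, hne, -, hρy⟩ := hy
  obtain ⟨-, hρy⟩ := hρy hyf
  have hp := hpos y hsrc hne
  set s := Real.sqrt (D y (a y)) with hs
  have hspos : 0 < s := Real.sqrt_pos.2 hp
  have hs2 : s * s = D y (a y) := Real.mul_self_sqrt hp.le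
  set ν : TangentSpace (𝓡 n) y := (tangentTriv x).symmL ℝ y (-s⁻¹ • a y)
  have hcoord : tangentCoord x ⟨y, ν⟩ = -s⁻¹ • a y := tangentCoord_symmL hsrc _
  have hνw : ∀ w : TangentSpace (𝓡 n) y,
      g.inner y ν w = -s⁻¹ * D y (tangentCoord x ⟨y, w⟩) := by
    intro w
    rw [← metricForm_tangentCoord g hsrc, hcoord, map_smul, hspec y hsrc, smul_apply, smul_eq_mul]
  have hν : IsInwardUnitNormal g Ω y ν := by
    refine ⟨?_, ρ, hρy, s, hspos, fun w => ?_⟩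
    · rw [hνw, hcoord, map_smul, smul_eq_mul, ← hs2]
      field_simp
    · rw [hνw, mfderiv_apply_eq_fderiv hsrc hmd]
      field_simp
      rfl
  rw [inwardNormal_eq hν]
  exact ⟨hν, hcoord⟩

theorem isInwardUnitNormal_inwardNormal (g : Metric n Q) {Ω : Set Q} (hΩ : IsObstacle n Ω)
    {x : Q} (hx : x ∈ frontier Ω) : IsInwardUnitNormal g Ω x (inwardNormal g Ω x) := by
  obtain ⟨ν, -, h⟩ := exists_continuousAt_inwardNormal g hΩ hx
  exact (h.self_of_nhds hx).1

theorem normalComponent_reflect (g : Metric n Q) {Ω : Set Q} (hΩ : IsObstacle n Ω)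
    {q : TangentBundle (𝓡 n) Q} (hq : q.1 ∈ frontier Ω) :
    normalComponent g Ω (reflect g Ω q) = -normalComponent g Ω q := by
  have h := (isInwardUnitNormal_inwardNormal g hΩ hq).1
  have : normalComponent g Ω (reflect g Ω q) =
    g.inner q.1 (q.2 - (2 * normalComponent g Ω q) • inwardNormal g Ω q.1)
      (inwardNormal g Ω q.1) := rfl
  rw [this, map_sub, map_smul, sub_apply, smul_apply, h, smul_eq_mul]
  change normalComponent g Ω q - _ = _
  ring

theorem reflect_mem_unitBundle (g : Metric n Q) {Ω : Set Q} (hΩ : IsObstacle n Ω)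
    {q : TangentBundle (𝓡 n) Q} (hq : q.1 ∈ frontier Ω) (hu : q ∈ unitBundle g) :
    reflect g Ω q ∈ unitBundle g := by
  have h := (isInwardUnitNormal_inwardNormal g hΩ hq).1
  change g.inner q.1 (q.2 - (2 * normalComponent g Ω q) • inwardNormal g Ω q.1)
    (q.2 - (2 * normalComponent g Ω q) • inwardNormal g Ω q.1) = 1
  have hu' : g.inner q.1 q.2 q.2 = 1 := hu
  have h1 : g.inner q.1 q.2 (inwardNormal g Ω q.1) = normalComponent g Ω q := rfl
  have h2 : g.inner q.1 (inwardNormal g Ω q.1) q.2 = normalComponent g Ω q := g.symm _ _ _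
  simp only [map_sub, map_smul, sub_apply, smul_apply, smul_eq_mul, hu', h1, h2, h]
  ring

theorem reflect_reflect (g : Metric n Q) {Ω : Set Q} (hΩ : IsObstacle n Ω)
    {q : TangentBundle (𝓡 n) Q} (hq : q.1 ∈ frontier Ω) :
    reflect g Ω (reflect g Ω q) = q := by
  have h := normalComponent_reflect g hΩ hq
  rw [reflect, h]
  have : q.2 - (2 * normalComponent g Ω q) • inwardNormal g Ω q.1 -
    (2 * -normalComponent g Ω q) • inwardNormal g Ω q.1 = q.2 := by module
  exact congrArg (Bundle.TotalSpace.mk q.1) this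

/-- Over the boundary, the normal component and the reflection are continuous. -/
theorem tendsto_normalComponent_reflect (g : Metric n Q) {Ω : Set Q} (hΩ : IsObstacle n Ω)
    {q₀ : TangentBundle (𝓡 n) Q} (hq₀ : q₀.1 ∈ frontier Ω) :
    Filter.Tendsto (normalComponent g Ω) (𝓝[{q | q.1 ∈ frontier Ω}] q₀)
        (𝓝 (normalComponent g Ω q₀)) ∧
      Filter.Tendsto (reflect g Ω) (𝓝[{q | q.1 ∈ frontier Ω}] q₀) (𝓝 (reflect g Ω q₀)) := by
  obtain ⟨ν, hν, hev⟩ := exists_continuousAt_inwardNormal g hΩ hq₀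
  set φ := extChartAt (𝓡 n) q₀.1
  have hb : ContinuousAt (fun q : TangentBundle (𝓡 n) Q => q.1) q₀ := continuous_base.continuousAt
  have hν' : ContinuousAt (fun q : TangentBundle (𝓡 n) Q => ν q.1) q₀ := hν.comp_of_eq hb rfl
  have hG : ContinuousAt (fun q : TangentBundle (𝓡 n) Q => metricForm g q₀.1 (φ q.1)) q₀ :=
    (contDiffAt_metricForm g (mem_extChartAt_target q₀.1)).continuousAt.comp_of_eq
      ((continuousAt_extChartAt (I := 𝓡 n) q₀.1).comp_of_eq hb rfl) rfl
  have hN : ContinuousAt (fun q : TangentBundle (𝓡 n) Q =>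
      metricForm g q₀.1 (φ q.1) (tangentCoord q₀.1 q) (ν q.1)) q₀ :=
    (hG.clm_apply (continuousAt_tangentCoord q₀)).clm_apply hν'
  have hR : ContinuousAt (fun q : TangentBundle (𝓡 n) Q => tangentCoord q₀.1 q +
      (-(2 * metricForm g q₀.1 (φ q.1) (tangentCoord q₀.1 q) (ν q.1))) • ν q.1) q₀ :=
    (continuousAt_tangentCoord q₀).add (((continuousAt_const.mul hN).neg).smul hν')
  have hall : ∀ᶠ q : TangentBundle (𝓡 n) Q in 𝓝 q₀, q.1 ∈ frontier Ω →
      normalComponent g Ω q = metricForm g q₀.1 (φ q.1) (tangentCoord q₀.1 q) (ν q.1) ∧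
      tangentCoord q₀.1 (reflect g Ω q) = tangentCoord q₀.1 q +
      (-(2 * metricForm g q₀.1 (φ q.1) (tangentCoord q₀.1 q) (ν q.1))) • ν q.1 := by
    filter_upwards [hb.eventually hev, hb.eventually (extChartAt_source_mem_nhds (I := 𝓡 n) q₀.1)]
      with q hq hsrc hqf
    have h1 : normalComponent g Ω q =
        metricForm g q₀.1 (φ q.1) (tangentCoord q₀.1 q) (ν q.1) := by
      rw [← (hq hqf).2]
      exact (metricForm_tangentCoord g hsrc q.2 (inwardNormal g Ω q.1)).symm
    refine ⟨h1, ?_⟩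
    rw [← h1, ← (hq hqf).2]
    have h2 : reflect g Ω q =
        ⟨q.1, q.2 + (-(2 * normalComponent g Ω q)) • inwardNormal g Ω q.1⟩ := by
      rw [reflect, neg_smul, sub_eq_add_neg]
    rw [h2, tangentCoord_add_smul hsrc]
  have hall' : ∀ᶠ q : TangentBundle (𝓡 n) Q in 𝓝[{q | q.1 ∈ frontier Ω}] q₀, _ :=
    Filter.eventually_inf_principal.2 hall
  have h0 := hall.self_of_nhds hq₀
  constructor
  · rw [h0.1]
    exact (hN.tendsto.mono_left nhdsWithin_le_nhds).congr' (hall'.mono fun q hq => hq.1.symm)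
  · refine tendsto_of_tangentCoord (hb.tendsto.mono_left nhdsWithin_le_nhds) ?_
    change Filter.Tendsto (fun q => tangentCoord q₀.1 (reflect g Ω q)) _
      (𝓝 (tangentCoord q₀.1 (reflect g Ω q₀)))
    rw [h0.2]
    exact (hR.tendsto.mono_left nhdsWithin_le_nhds).congr' (hall'.mono fun q hq => hq.2.symm)

end Normals

/-! ### Geodesics that leave the obstacle transversally -/

section LeavingTheObstacle

variable {n : ℕ} {Q : Type*} [TopologicalSpace Q] [ChartedSpace (EuclideanSpace ℝ (Fin n)) Q]
  [IsManifold (𝓡 n) ∞ Q]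

local notation "𝔼" => EuclideanSpace ℝ (Fin n)

theorem hasDerivAt_comp_curve {γ : ℝ → Q} (hγ : ContMDiff 𝓘(ℝ, ℝ) (𝓡 n) ∞ γ) {ρ : Q → ℝ}
    {x₀ : Q} {t : ℝ} (ht : γ t ∈ (extChartAt (𝓡 n) x₀).source)
    (hρ : MDifferentiableAt (𝓡 n) 𝓘(ℝ, ℝ) ρ (γ t)) :
    HasDerivAt (fun s => ρ (γ s))
      (fderiv ℝ (ρ ∘ (extChartAt (𝓡 n) x₀).symm) (extChartAt (𝓡 n) x₀ (γ t))
        (tangentCoord x₀ (velocityLift γ t))) t := by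
  have hγ' := ((hγ t).mdifferentiableAt (by simp)).hasMFDerivAt
  obtain ⟨D, hD, hD1⟩ : ∃ D : ℝ →L[ℝ] ℝ, HasFDerivAt (fun s => ρ (γ s)) D t ∧
      D 1 = fderiv ℝ (ρ ∘ (extChartAt (𝓡 n) x₀).symm) (extChartAt (𝓡 n) x₀ (γ t))
        (tangentCoord x₀ (velocityLift γ t)) :=
    ⟨_, hasMFDerivAt_iff_hasFDerivAt.1 (hρ.hasMFDerivAt.comp t hγ'),
      mfderiv_apply_eq_fderiv ht hρ _⟩
  rw [← hD1]
  exact hD.hasDerivAt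

/-- A vector at the boundary that points out of `Ω` increases some local defining function. -/
theorem exists_fderiv_pos {g : Metric n Q} {Ω : Set Q} (hΩ : IsObstacle n Ω)
    {q : TangentBundle (𝓡 n) Q} (hq : q.1 ∈ frontier Ω) :
    ∃ (ρ : Q → ℝ) (c : ℝ), 0 < c ∧ IsLocalDefiningFunction (n := n) Ω q.1 ρ ∧
      fderiv ℝ (ρ ∘ (extChartAt (𝓡 n) q.1).symm) (extChartAt (𝓡 n) q.1 q.1)
        (tangentCoord q.1 q) = -c * normalComponent g Ω q := by
  obtain ⟨-, ρ, hρ, c, hc, h⟩ := isInwardUnitNormal_inwardNormal g hΩ hq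
  refine ⟨ρ, c, hc, hρ, ?_⟩
  have h1 := h q.2
  rw [mfderiv_apply_eq_fderiv (mem_extChartAt_source q.1) hρ.mdifferentiableAt, g.symm] at h1
  exact h1

/-- Along the curve a defining function starts at 0, and its derivative there is a negative multiple
of `σ * normalComponent g Ω q`, hence positive. -/
theorem eventually_geodesicFlow_notMem {g : Metric n Q} (hg : IsComplete g) {Ω : Set Q}
    (hΩ : IsObstacle n Ω) {q : TangentBundle (𝓡 n) Q} (hq : q.1 ∈ frontier Ω) {σ : ℝ}
    (hσ : σ * normalComponent g Ω q < 0) :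
    ∀ᶠ t in 𝓝[>] (0 : ℝ), (geodesicFlow g (σ * t) q).1 ∉ Ω := by
  obtain ⟨ρ, c, hc, hρ, hd⟩ := exists_fderiv_pos (g := g) hΩ hq
  obtain ⟨γ, hγ, h0, hflow⟩ := exists_geodesicFlow_eq hg q
  have hγ0 : γ 0 = q.1 := congrArg (fun p => p.1) h0
  have h1 := hasDerivAt_comp_curve hγ.1 (x₀ := q.1) (t := 0) (ρ := ρ)
    (by rw [hγ0]; exact mem_extChartAt_source _) (by rw [hγ0]; exact hρ.mdifferentiableAt)
  rw [h0, hγ0, hd] at h1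
  have h2 : HasDerivAt (fun t => ρ (γ (σ * t))) (-c * normalComponent g Ω q * σ) 0 := by
    have h3 : HasDerivAt (fun t : ℝ => σ * t) σ 0 := by
      simpa using (hasDerivAt_id (0 : ℝ)).const_mul σ
    exact HasDerivAt.comp_of_eq (0 : ℝ) h1 h3 (by simp)
  have h4 := eventually_pos_of_hasDerivAt_pos h2 (by simp [hγ0, hρ.1]) (by nlinarith)
  have hcont : Continuous fun t : ℝ => γ (σ * t) :=
    hγ.1.continuous.comp (continuous_const.mul continuous_id)
  have h5 : ∀ᶠ t in 𝓝 (0 : ℝ), _ := (hcont.tendsto' 0 q.1 (by rw [mul_zero, hγ0])).eventually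
    (hρ.eventually hΩ.1)
  filter_upwards [h4, nhdsWithin_le_nhds h5] with t ht1 ht2
  rw [hflow]
  exact fun hmem => not_lt.2 (ht2.2.2.2.1.1 hmem) ht1

/-- Geodesics that start at boundary points near an outward vector stay outside of `Ω` for a
definite time. -/
theorem exists_geodesicFlow_notMem [T2Space Q] {g : Metric n Q} (hg : IsComplete g) {Ω : Set Q}
    (hΩ : IsObstacle n Ω) {q₀ : TangentBundle (𝓡 n) Q} (hq₀ : q₀.1 ∈ frontier Ω)
    (hn : normalComponent g Ω q₀ < 0) :
    ∃ ε > 0, ∀ᶠ q in 𝓝 q₀, q ∈ unitBundle g → q.1 ∈ frontier Ω → ∀ t ∈ Ioo 0 ε,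
      (geodesicFlow g t q).1 ∉ Ω := by
  obtain ⟨ρ, c, hc, hρ, hd⟩ := exists_fderiv_pos (g := g) hΩ hq₀
  have hpos : 0 < -c * normalComponent g Ω q₀ := by nlinarith
  obtain ⟨-, -, U, hU, hxU, hs, hΩU⟩ := id hρ
  have hb : ContinuousAt (fun q : TangentBundle (𝓡 n) Q => q.1) q₀ := continuous_base.continuousAt
  have hDc : ContinuousAt (fun q : TangentBundle (𝓡 n) Q =>
      fderiv ℝ (ρ ∘ (extChartAt (𝓡 n) q₀.1).symm) (extChartAt (𝓡 n) q₀.1 q.1)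
        (tangentCoord q₀.1 q)) q₀ :=
    ContinuousAt.clm_apply (ContinuousAt.comp_of_eq
      ((contDiffAt_comp_extChartAt_symm hU hxU hs).fderiv_right (m := 0) (by simp)).continuousAt
      ((continuousAt_extChartAt (I := 𝓡 n) q₀.1).comp_of_eq hb rfl) rfl)
      (continuousAt_tangentCoord q₀)
  -- On this neighborhood of `q₀` every vector increases `ρ`. A geodesic that stays in it has `ρ`
  -- strictly increasing from the value 0 at its initial boundary point.
  have hN := ((hb.eventually (hρ.eventually hΩ.1)).and
    (hDc.eventually (lt_mem_nhds (hpos.trans_eq hd.symm))))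
  obtain ⟨ε, hε, h⟩ := exists_geodesicFlow_mem hg hN
  refine ⟨ε, hε, ?_⟩
  filter_upwards [h, hN] with q hq hqN hunit hqf t ht
  obtain ⟨γ, hγ, h0, hflow⟩ := exists_geodesicFlow_eq hg q
  have hγ0 : γ 0 = q.1 := congrArg (fun p => p.1) h0
  have hγN := hq hunit
  simp_rw [hflow] at hγN ⊢
  have hderiv : ∀ s ∈ Ico 0 ε, HasDerivAt (fun s => ρ (γ s)) _ s := fun s hs =>
    hasDerivAt_comp_curve hγ.1 (hγN s hs).1.2.1 (hγN s hs).1.1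
  have hmono : StrictMonoOn (fun s => ρ (γ s)) (Icc 0 t) := by
    refine strictMonoOn_of_deriv_pos (convex_Icc 0 t)
      (fun s hs => (hderiv s ⟨hs.1, hs.2.trans_lt ht.2⟩).continuousAt.continuousWithinAt) ?_
    intro s hs
    rw [interior_Icc] at hs
    have hs' : s ∈ Ico 0 ε := ⟨hs.1.le, hs.2.trans ht.2⟩
    rw [(hderiv s hs').deriv]
    exact (hγN s hs').2
  have hlt := hmono ⟨le_rfl, ht.1.le⟩ ⟨ht.1.le, le_rfl⟩ ht.1
  have hz : ρ (γ 0) = 0 := by rw [hγ0]; exact (hqN.1.2.2.2.2 hqf).1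
  simp only [hz] at hlt
  intro hmem
  exact absurd ((hγN t ⟨ht.1.le, ht.2⟩).1.2.2.2.1.1 hmem) (not_le.2 hlt)

end LeavingTheObstacle

/-! ### Collisions and short-time behavior of the billiard flow -/

section Flow

variable {n : ℕ} {Q : Type*} [TopologicalSpace Q] [ChartedSpace (EuclideanSpace ℝ (Fin n)) Q]
  [IsManifold (𝓡 n) ∞ Q] {g : Metric n Q} {Ω : Set Q}

theorem start_fst (σ : ℝ) (q : TangentBundle (𝓡 n) Q) : (start g Ω σ q).1 = q.1 := by
  rw [start]
  split_ifs <;> rfl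

theorem start_of_notMem (hΩ : IsClosed Ω) (σ : ℝ) {q : TangentBundle (𝓡 n) Q} (hq : q.1 ∉ Ω) :
    start g Ω σ q = q := by
  rw [start, if_neg fun h => hq (hΩ.frontier_subset h.1)]

theorem start_eq_or (σ : ℝ) (q : TangentBundle (𝓡 n) Q) :
    start g Ω σ q = q ∨ q.1 ∈ frontier Ω ∧ start g Ω σ q = reflect g Ω q := by
  rw [start]
  split_ifs with h
  · exact Or.inr ⟨h.1, rfl⟩
  · exact Or.inl rfl

theorem start_mem_unitBundle (hΩ : IsObstacle n Ω) (σ : ℝ) {q : TangentBundle (𝓡 n) Q}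
    (hq : q ∈ unitBundle g) : start g Ω σ q ∈ unitBundle g := by
  rcases start_eq_or (g := g) (Ω := Ω) σ q with h | ⟨h1, h⟩ <;> rw [h]
  · exact hq
  · exact reflect_mem_unitBundle g hΩ h1 hq

theorem phaseInterior_subset (hΩ : IsClosed Ω) : phaseInterior g Ω ⊆ nonGrazing g Ω :=
  fun _ hq => ⟨⟨hq.1, fun h => hq.2 (interior_subset h)⟩,
    fun h => hq.2 (hΩ.frontier_subset h.2.1)⟩

theorem mem_phaseInterior_or (q : TangentBundle (𝓡 n) Q) (hq : q ∈ nonGrazing g Ω) :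
    q ∈ phaseInterior g Ω ∨ q.1 ∈ frontier Ω ∧ normalComponent g Ω q ≠ 0 := by
  by_cases h : q.1 ∈ Ω
  · have hf : q.1 ∈ frontier Ω := ⟨subset_closure h, hq.1.2⟩
    exact Or.inr ⟨hf, fun h0 => hq.2 ⟨hq.1.1, hf, h0⟩⟩
  · exact Or.inl ⟨hq.1.1, h⟩

theorem mem_nonGrazing_of_frontier {q : TangentBundle (𝓡 n) Q} (hu : q ∈ unitBundle g)
    (hf : q.1 ∈ frontier Ω) (hn : normalComponent g Ω q ≠ 0) : q ∈ nonGrazing g Ω :=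
  ⟨⟨hu, hf.2⟩, fun h => hn h.2.2⟩

theorem reflect_mem_nonGrazing (hΩ : IsObstacle n Ω) {q : TangentBundle (𝓡 n) Q}
    (hq : q ∈ nonGrazing g Ω) (hf : q.1 ∈ frontier Ω) : reflect g Ω q ∈ nonGrazing g Ω := by
  refine mem_nonGrazing_of_frontier (reflect_mem_unitBundle g hΩ hf hq.1.1) hf ?_
  rw [normalComponent_reflect g hΩ hf, neg_ne_zero]
  exact fun h0 => hq.2 ⟨hq.1.1, hf, h0⟩

/-- `start` reflects exactly when the sign is wrong, so in the direction of time `σ` the motion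
always departs from `Ω`. This makes hitting times positive. -/
theorem mul_normalComponent_start_neg (hΩ : IsObstacle n Ω) {q : TangentBundle (𝓡 n) Q}
    (hf : q.1 ∈ frontier Ω) (hn : normalComponent g Ω q ≠ 0) {σ : ℝ} (hσ : σ ≠ 0) :
    σ * normalComponent g Ω (start g Ω σ q) < 0 := by
  rw [start]
  split_ifs with h
  · rw [normalComponent_reflect g hΩ hf]
    linarith [h.2]
  · have : σ * normalComponent g Ω q ≠ 0 := mul_ne_zero hσ hn
    exact lt_of_le_of_ne (not_lt.1 fun h' => h ⟨hf, h'⟩) this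

theorem eventually_flow_start_notMem (hg : IsComplete g) (hΩ : IsObstacle n Ω)
    {q : TangentBundle (𝓡 n) Q} (hq : q ∈ nonGrazing g Ω) {σ : ℝ} (hσ : σ ≠ 0) :
    ∀ᶠ t in 𝓝[>] (0 : ℝ), (geodesicFlow g (σ * t) (start g Ω σ q)).1 ∉ Ω := by
  rcases mem_phaseInterior_or q hq with h | ⟨hf, hn⟩
  · have hc : Continuous fun t : ℝ => (geodesicFlow g (σ * t) (start g Ω σ q)).1 :=
      (continuous_geodesicFlow_fst hg _).comp (continuous_const.mul continuous_id)
    refine nhdsWithin_le_nhds (hc.continuousAt.eventually (hΩ.1.isOpen_compl.mem_nhds ?_))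
    simp only [mul_zero, geodesicFlow_zero hg, start_fst]
    exact h.2
  · exact eventually_geodesicFlow_notMem hg hΩ (by rwa [start_fst])
      (mul_normalComponent_start_neg hΩ hf hn hσ)

theorem le_hitTime {σ ε : ℝ} {q : TangentBundle (𝓡 n) Q}
    (h : ∀ t ∈ Ioo 0 ε, (geodesicFlow g (σ * t) (start g Ω σ q)).1 ∉ Ω) :
    (ε : EReal) ≤ hitTime g Ω σ q := by
  refine le_sInf ?_
  rintro _ ⟨t, ht, rfl, hmem⟩
  by_contra! hlt
  exact h t ⟨ht, EReal.coe_lt_coe_iff.1 hlt⟩ hmem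

theorem hitTime_pos (hg : IsComplete g) (hΩ : IsObstacle n Ω) {q : TangentBundle (𝓡 n) Q}
    (hq : q ∈ nonGrazing g Ω) {σ : ℝ} (hσ : σ ≠ 0) : 0 < hitTime g Ω σ q := by
  obtain ⟨ε, hε, h⟩ := mem_nhdsGT_iff_exists_Ioo_subset.1
    (eventually_flow_start_notMem hg hΩ hq hσ)
  exact lt_of_lt_of_le (EReal.coe_pos.2 hε) (le_hitTime fun t ht => h ht)

theorem notMem_of_lt_hitTime {σ t : ℝ} {q : TangentBundle (𝓡 n) Q} (ht : 0 < t)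
    (hlt : (t : EReal) < hitTime g Ω σ q) : (geodesicFlow g (σ * t) (start g Ω σ q)).1 ∉ Ω :=
  fun h => not_le.2 hlt (sInf_le ⟨t, ht, rfl, h⟩)

theorem hitTime_coe_toReal (hg : IsComplete g) (hΩ : IsObstacle n Ω) {q : TangentBundle (𝓡 n) Q}
    (hq : q ∈ nonGrazing g Ω) {σ : ℝ} (hσ : σ ≠ 0) (htop : hitTime g Ω σ q ≠ ⊤) :
    ((hitTime g Ω σ q).toReal : EReal) = hitTime g Ω σ q :=
  EReal.coe_toReal htop (ne_bot_of_gt (hitTime_pos hg hΩ hq hσ))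

/-- The next encounter with the obstacle takes place in the boundary. -/
theorem hitPoint_fst_mem (hg : IsComplete g) (hΩ : IsObstacle n Ω) {q : TangentBundle (𝓡 n) Q}
    (hq : q ∈ nonGrazing g Ω) {σ : ℝ} (hσ : σ ≠ 0) (htop : hitTime g Ω σ q ≠ ⊤) :
    (hitPoint g Ω σ q).1 ∈ frontier Ω := by
  have hT := hitTime_coe_toReal hg hΩ hq hσ htop
  have hpos := hitTime_pos hg hΩ hq hσ
  rw [hitPoint]
  set T := (hitTime g Ω σ q).toReal
  rw [← hT] at hpos
  replace hpos := EReal.coe_pos.1 hpos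
  have hbefore : ∀ t ∈ Ioo 0 T, (geodesicFlow g (σ * t) (start g Ω σ q)).1 ∉ Ω := fun t ht =>
    notMem_of_lt_hitTime ht.1 (by rw [← hT]; exact EReal.coe_lt_coe_iff.2 ht.2)
  have hc : Continuous fun t : ℝ => (geodesicFlow g (σ * t) (start g Ω σ q)).1 :=
    (continuous_geodesicFlow_fst hg _).comp (continuous_const.mul continuous_id)
  -- If the point missed the closed set `Ω`, the curve would avoid `Ω` for a further time `δ`; if it
  -- were interior to `Ω`, the curve would have met `Ω` earlier.
  refine ⟨subset_closure (by_contra fun hne => ?_), fun hint => ?_⟩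
  · obtain ⟨δ, hδ, hball⟩ := Metric.mem_nhds_iff.1
      ((hc.tendsto T).eventually (hΩ.1.isOpen_compl.mem_nhds hne))
    have : ((T + δ : ℝ) : EReal) ≤ hitTime g Ω σ q := by
      refine le_hitTime fun t ht => ?_
      by_cases h : t < T
      · exact hbefore t ⟨ht.1, h⟩
      · refine hball ?_
        rw [Metric.mem_ball, Real.dist_eq, abs_of_nonneg (by linarith)]
        linarith [ht.2]
    rw [← hT, EReal.coe_le_coe_iff] at this
    linarith
  · have h1 := (hc.tendsto T).eventually (isOpen_interior.mem_nhds hint)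
    have h2 : ∀ᶠ t in 𝓝[<] T, t ∈ Ioo 0 T := Ioo_mem_nhdsLT hpos
    obtain ⟨t, ht1, ht2⟩ := ((h1.filter_mono nhdsWithin_le_nhds).and h2).exists
    exact hbefore t ht2 (interior_subset ht1)

theorem hitPoint_mem_nonGrazing (hg : IsComplete g) (hΩ : IsObstacle n Ω)
    {q : TangentBundle (𝓡 n) Q} (hq : q ∈ nonGrazing g Ω) {σ : ℝ} (hσ : σ ≠ 0)
    (htop : hitTime g Ω σ q ≠ ⊤) (hgr : hitPoint g Ω σ q ∉ grazing g Ω) :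
    hitPoint g Ω σ q ∈ nonGrazing g Ω :=
  ⟨⟨geodesicFlow_mem_unitBundle hg (start_mem_unitBundle hΩ σ hq.1.1) _,
    (hitPoint_fst_mem hg hΩ hq hσ htop).2⟩, hgr⟩

theorem collision_succ_eq (σ : ℝ) (q : TangentBundle (𝓡 n) Q) (k : ℕ) :
    (hitTime g Ω σ (collision g Ω σ q k).2 ≠ ⊤ ∧
      hitPoint g Ω σ (collision g Ω σ q k).2 ∉ grazing g Ω ∧
      collision g Ω σ q (k + 1) =
        ((collision g Ω σ q k).1 + (hitTime g Ω σ (collision g Ω σ q k).2).toReal,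
          hitPoint g Ω σ (collision g Ω σ q k).2)) ∨
    (¬(hitTime g Ω σ (collision g Ω σ q k).2 ≠ ⊤ ∧
      hitPoint g Ω σ (collision g Ω σ q k).2 ∉ grazing g Ω) ∧
      collision g Ω σ q (k + 1) = collision g Ω σ q k) := by
  by_cases h : hitTime g Ω σ (collision g Ω σ q k).2 ≠ ⊤ ∧
      hitPoint g Ω σ (collision g Ω σ q k).2 ∉ grazing g Ω
  · refine Or.inl ⟨h.1, h.2, ?_⟩
    rw [collision]
    exact if_pos h
  · refine Or.inr ⟨h, ?_⟩
    rw [collision]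
    exact if_neg h

theorem collision_mem_nonGrazing (hg : IsComplete g) (hΩ : IsObstacle n Ω)
    {q : TangentBundle (𝓡 n) Q} (hq : q ∈ nonGrazing g Ω) {σ : ℝ} (hσ : σ ≠ 0) (k : ℕ) :
    (collision g Ω σ q k).2 ∈ nonGrazing g Ω := by
  induction k with
  | zero => exact hq
  | succ k ih =>
    rcases collision_succ_eq (g := g) (Ω := Ω) σ q k with ⟨h1, h2, h3⟩ | ⟨-, h⟩
    · rw [h3]
      exact hitPoint_mem_nonGrazing hg hΩ ih hσ h1 h2
    · rw [h]
      exact ih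

/-- The recursion depends on the preceding value only, so a value repeated once is repeated forever.
-/
theorem collision_eq_of_succ_eq {σ : ℝ} {q : TangentBundle (𝓡 n) Q} {k : ℕ}
    (h : collision g Ω σ q (k + 1) = collision g Ω σ q k) (j : ℕ) (hj : k ≤ j) :
    collision g Ω σ q j = collision g Ω σ q k := by
  induction j, hj using Nat.le_induction with
  | base => rfl
  | succ j hj ih =>
    rw [← ih] at h
    have e : collision g Ω σ q (k + 1) = collision g Ω σ q (j + 1) := by
      rw [collision, collision, ih]
    rw [← e, h, ih]

theorem exitTime_zero (σ : ℝ) (q : TangentBundle (𝓡 n) Q) :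
    exitTime g Ω σ q 0 = hitTime g Ω σ q := by
  rw [exitTime, collision]
  exact zero_add _

theorem hitTime_le_lifetime (σ : ℝ) (q : TangentBundle (𝓡 n) Q) :
    hitTime g Ω σ q ≤ lifetime g Ω σ q := by
  rw [← exitTime_zero]
  exact le_iSup (exitTime g Ω σ q) 0

theorem sInf_le_exitTime_eq_zero {σ t : ℝ} {q : TangentBundle (𝓡 n) Q}
    (h : (t : EReal) ≤ hitTime g Ω σ q) : sInf {k : ℕ | (t : EReal) ≤ exitTime g Ω σ q k} = 0 :=
  Nat.sInf_eq_zero.2 (Or.inl (by rwa [mem_ofPred_eq, exitTime_zero]))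

/-- Up to the first collision, the trajectory is a geodesic. -/
theorem advance_eq {σ t : ℝ} {q : TangentBundle (𝓡 n) Q} (h : (t : EReal) ≤ hitTime g Ω σ q) :
    advance g Ω σ t q = geodesicFlow g (σ * t) (start g Ω σ q) := by
  rw [advance, sInf_le_exitTime_eq_zero h]
  simp [collision]

/-- The trajectory between the first and the second collision. -/
theorem advance_eq_of_one_collision {σ t : ℝ} {q : TangentBundle (𝓡 n) Q}
    (h : hitTime g Ω σ q < t) (hgr : hitPoint g Ω σ q ∉ grazing g Ω)
    (h2 : ((t - (hitTime g Ω σ q).toReal : ℝ) : EReal) ≤ hitTime g Ω σ (hitPoint g Ω σ q)) :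
    advance g Ω σ t q = geodesicFlow g (σ * (t - (hitTime g Ω σ q).toReal))
      (start g Ω σ (hitPoint g Ω σ q)) := by
  have htop : hitTime g Ω σ q ≠ ⊤ := ne_top_of_lt h
  have hc : collision g Ω σ q 1 = ((hitTime g Ω σ q).toReal, hitPoint g Ω σ q) := by
    rcases collision_succ_eq (g := g) (Ω := Ω) σ q 0 with ⟨-, -, h3⟩ | ⟨h3, -⟩
    · rw [h3]
      simp [collision]
    · exact absurd ⟨htop, hgr⟩ h3
  have hmem : (t : EReal) ≤ exitTime g Ω σ q 1 := by
    rw [exitTime, hc]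
    calc (t : EReal) = (((hitTime g Ω σ q).toReal + (t - (hitTime g Ω σ q).toReal) : ℝ) : EReal) := by
          congr 1; ring
      _ = ((hitTime g Ω σ q).toReal : EReal) + ((t - (hitTime g Ω σ q).toReal : ℝ) : EReal) :=
          EReal.coe_add _ _
      _ ≤ _ := by gcongr
  have hinf : sInf {k : ℕ | (t : EReal) ≤ exitTime g Ω σ q k} = 1 := by
    refine le_antisymm (Nat.sInf_le hmem) (Nat.one_le_iff_ne_zero.2 fun h0 => ?_)
    have := Nat.sInf_mem (s := {k : ℕ | (t : EReal) ≤ exitTime g Ω σ q k}) ⟨1, hmem⟩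
    rw [h0, mem_ofPred_eq, exitTime_zero] at this
    exact not_le.2 h this
  rw [advance, hinf, hc]

/-- Trajectories stay in the non-grazing phase space. -/
theorem advance_mem_nonGrazing (hg : IsComplete g) (hΩ : IsObstacle n Ω)
    {q : TangentBundle (𝓡 n) Q} (hq : q ∈ nonGrazing g Ω) {σ : ℝ} (hσ : σ ≠ 0) {t : ℝ}
    (ht : 0 < t) (hlt : (t : EReal) < lifetime g Ω σ q) :
    advance g Ω σ t q ∈ nonGrazing g Ω := by
  set S := {k : ℕ | (t : EReal) ≤ exitTime g Ω σ q k} with hS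
  have hne : S.Nonempty := by
    obtain ⟨k, hk⟩ := lt_iSup_iff.1 hlt
    exact ⟨k, hk.le⟩
  have hmem : sInf S ∈ S := Nat.sInf_mem hne
  have hmin : ∀ j < sInf S, exitTime g Ω σ q j < t := fun j hj =>
    not_le.1 fun h => Nat.notMem_of_lt_sInf hj h
  rw [advance, ← hS]
  set k := sInf S with hk
  set c := collision g Ω σ q k with hcdef
  have hc := collision_mem_nonGrazing hg hΩ hq hσ k
  rw [← hcdef] at hc
  -- For `k = j + 1`, collision `k` takes place at `exitTime` number `j`, which is below `t` by
  -- minimality of `k`. If the recursion had stopped at `j`, the exit times `j` and `k` would agree,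
  -- against the choice of `k`.
  have hct : c.1 < t := by
    rcases Nat.eq_zero_or_pos k with h0 | h0
    · rw [hcdef, h0]
      exact ht
    · obtain ⟨j, hj⟩ := Nat.exists_eq_succ_of_ne_zero h0.ne'
      have hjt := hmin j (by omega)
      rcases collision_succ_eq (g := g) (Ω := Ω) σ q j with ⟨h1, -, h3⟩ | ⟨-, h⟩
      · have hcj := collision_mem_nonGrazing hg hΩ hq hσ j
        rw [exitTime, ← hitTime_coe_toReal hg hΩ hcj hσ h1, ← EReal.coe_add,
          EReal.coe_lt_coe_iff] at hjt
        rw [hcdef, hj, Nat.succ_eq_add_one, h3]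
        exact hjt
      · exfalso
        have : exitTime g Ω σ q k = exitTime g Ω σ q j := by
          rw [hj, Nat.succ_eq_add_one, exitTime, h, exitTime]
        rw [← this] at hjt
        exact not_le.2 hjt hmem
  have hle : ((t - c.1 : ℝ) : EReal) ≤ hitTime g Ω σ c.2 := by
    have h1 : (t : EReal) ≤ c.1 + hitTime g Ω σ c.2 := hmem
    rw [EReal.coe_sub]
    exact EReal.sub_le_of_le_add' h1
  have hunit := geodesicFlow_mem_unitBundle hg (start_mem_unitBundle hΩ σ hc.1.1) (σ * (t - c.1))
  rcases hle.lt_or_eq with h | h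
  · exact phaseInterior_subset hΩ.1 ⟨hunit, notMem_of_lt_hitTime (sub_pos.2 hct) h⟩
  · have htop : hitTime g Ω σ c.2 ≠ ⊤ := by
      rw [← h]
      exact EReal.coe_ne_top _
    have hpt : geodesicFlow g (σ * (t - c.1)) (start g Ω σ c.2) = hitPoint g Ω σ c.2 := by
      rw [hitPoint, ← h, EReal.toReal_coe]
    rw [hpt]
    -- Here `t` is exactly the next hitting time. A grazing hit would stop the recursion at `k`, and
    -- the lifetime could not exceed `t`.
    refine hitPoint_mem_nonGrazing hg hΩ hc hσ htop fun hgr => not_le.2 hlt ?_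
    rcases collision_succ_eq (g := g) (Ω := Ω) σ q k with ⟨-, h2, -⟩ | ⟨-, hsame⟩
    · exact absurd hgr h2
    refine iSup_le fun j => ?_
    rcases lt_or_ge j k with hj | hj
    · exact (hmin j hj).le
    · rw [exitTime, collision_eq_of_succ_eq hsame j hj, ← hcdef, ← h, ← EReal.coe_add]
      simp

theorem billiardFlow_mem_nonGrazing (hg : IsComplete g) (hΩ : IsObstacle n Ω)
    {p : ℝ × TangentBundle (𝓡 n) Q} (hp : p ∈ billiardDomain g Ω) :
    billiardFlow g Ω p.1 p.2 ∈ nonGrazing g Ω := by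
  obtain ⟨hq, h1, h2⟩ := hp
  rw [billiardFlow]
  split_ifs with h h'
  · exact advance_mem_nonGrazing hg hΩ hq one_ne_zero h h2
  · refine advance_mem_nonGrazing hg hΩ hq (by norm_num) (neg_pos.2 h') ?_
    rw [EReal.coe_neg]
    exact EReal.neg_lt_comm.1 h1
  · exact hq

theorem billiardFlow_zero (q : TangentBundle (𝓡 n) Q) : billiardFlow g Ω 0 q = q := by
  simp [billiardFlow]

theorem eventually_mem_billiardDomain (hg : IsComplete g) (hΩ : IsObstacle n Ω)
    {q : TangentBundle (𝓡 n) Q} (hq : q ∈ nonGrazing g Ω) :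
    ∀ᶠ t : ℝ in 𝓝 0, (t, q) ∈ billiardDomain g Ω := by
  have h1 := (hitTime_pos hg hΩ hq one_ne_zero).trans_le (hitTime_le_lifetime 1 q)
  have h2 := (hitTime_pos hg hΩ hq (neg_ne_zero.2 one_ne_zero)).trans_le
    (hitTime_le_lifetime (-1) q)
  have h2' : -lifetime g Ω (-1) q < 0 := by
    rw [EReal.neg_lt_comm]
    simpa using h2
  have hc : Filter.Tendsto (fun t : ℝ => (t : EReal)) (𝓝 0) (𝓝 0) :=
    continuous_coe_real_ereal.tendsto 0
  filter_upwards [hc.eventually (lt_mem_nhds h2'), hc.eventually (gt_mem_nhds h1)] with t ht1 ht2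
  exact ⟨hq, ht1, ht2⟩

/-- For short positive times, the flow is the geodesic flow and runs in the interior. -/
theorem eventually_billiardFlow_pos (hg : IsComplete g) (hΩ : IsObstacle n Ω)
    {q : TangentBundle (𝓡 n) Q} (hq : q ∈ nonGrazing g Ω) :
    ∀ᶠ t in 𝓝[>] (0 : ℝ), billiardFlow g Ω t q = geodesicFlow g t (start g Ω 1 q) ∧
      billiardFlow g Ω t q ∈ phaseInterior g Ω := by
  have h1 := hitTime_pos hg hΩ hq one_ne_zero
  have hc : Filter.Tendsto (fun t : ℝ => (t : EReal)) (𝓝 0) (𝓝 0) :=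
    continuous_coe_real_ereal.tendsto 0
  filter_upwards [nhdsWithin_le_nhds (hc.eventually (gt_mem_nhds h1)), self_mem_nhdsWithin]
    with t ht ht0
  have e : billiardFlow g Ω t q = geodesicFlow g t (start g Ω 1 q) := by
    rw [billiardFlow, if_pos (mem_Ioi.1 ht0), advance_eq ht.le, one_mul]
  refine ⟨e, ?_⟩
  rw [e]
  refine ⟨geodesicFlow_mem_unitBundle hg (start_mem_unitBundle hΩ 1 hq.1.1) t, ?_⟩
  have := notMem_of_lt_hitTime (mem_Ioi.1 ht0) ht
  rwa [one_mul] at this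

/-- For short negative times, the flow is the geodesic flow and runs in the interior. -/
theorem eventually_billiardFlow_neg (hg : IsComplete g) (hΩ : IsObstacle n Ω)
    {q : TangentBundle (𝓡 n) Q} (hq : q ∈ nonGrazing g Ω) :
    ∀ᶠ t in 𝓝[>] (0 : ℝ), billiardFlow g Ω (-t) q = geodesicFlow g (-t) (start g Ω (-1) q) ∧
      billiardFlow g Ω (-t) q ∈ phaseInterior g Ω := by
  have h1 := hitTime_pos hg hΩ hq (neg_ne_zero.2 one_ne_zero)
  have hc : Filter.Tendsto (fun t : ℝ => (t : EReal)) (𝓝 0) (𝓝 0) :=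
    continuous_coe_real_ereal.tendsto 0
  filter_upwards [nhdsWithin_le_nhds (hc.eventually (gt_mem_nhds h1)), self_mem_nhdsWithin]
    with t ht ht0
  have ht0' := mem_Ioi.1 ht0
  have e : billiardFlow g Ω (-t) q = geodesicFlow g (-t) (start g Ω (-1) q) := by
    rw [billiardFlow, if_neg (by linarith), if_pos (by linarith), neg_neg, advance_eq ht.le,
      neg_one_mul]
  refine ⟨e, ?_⟩
  rw [e]
  refine ⟨geodesicFlow_mem_unitBundle hg (start_mem_unitBundle hΩ (-1) hq.1.1) (-t), ?_⟩
  have := notMem_of_lt_hitTime ht0' ht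
  rwa [neg_one_mul] at this

end Flow

/-! ### Fibers of the projection and descent of billiard functions -/

section Model

variable {n m : ℕ} {Q : Type*} [TopologicalSpace Q] [ChartedSpace (EuclideanSpace ℝ (Fin n)) Q]
  [IsManifold (𝓡 n) ∞ Q] {g : Metric n Q} {Ω : Set Q}
  {𝓜 : Type*} [TopologicalSpace 𝓜] [ChartedSpace (EuclideanSpace ℝ (Fin m)) 𝓜]
  {π : TangentBundle (𝓡 n) Q → 𝓜} {ϕ : ℝ → 𝓜 → 𝓜}

/-- Base points of the two limits agree since `Q` is Hausdorff; then coordinates over this common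
point can be compared. -/
theorem tendsto_nhds_unique_tangentBundle [T2Space Q] {α : Type*} {l : Filter α} [l.NeBot]
    {f : α → TangentBundle (𝓡 n) Q} {a b : TangentBundle (𝓡 n) Q}
    (ha : Filter.Tendsto f l (𝓝 a)) (hb : Filter.Tendsto f l (𝓝 b)) : a = b := by
  obtain ⟨x, v⟩ := a
  obtain ⟨y, w⟩ := b
  obtain rfl : x = y := tendsto_nhds_unique ((continuous_base.tendsto _).comp ha)
    ((continuous_base.tendsto _).comp hb)
  have h := tendsto_nhds_unique ((continuousAt_tangentCoord (⟨x, v⟩ : TangentBundle (𝓡 n) Q)).tendsto.comp ha)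
    ((continuousAt_tangentCoord (⟨x, w⟩ : TangentBundle (𝓡 n) Q)).tendsto.comp hb)
  have hx := mem_extChartAt_source (I := 𝓡 n) x
  have h1 := symmL_tangentCoord (q := ⟨x, v⟩) hx
  have h2 := symmL_tangentCoord (q := ⟨x, w⟩) hx
  exact congrArg (Bundle.TotalSpace.mk x)
    (h1.symm.trans ((congrArg ((tangentTriv x).symmL ℝ x) h).trans h2))

theorem IsSmoothModel.mem_modelDomain {p : ℝ × TangentBundle (𝓡 n) Q}
    (hp : p ∈ billiardDomain g Ω) : (p.1, π p.2) ∈ modelDomain g Ω π :=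
  ⟨p, hp, rfl⟩

theorem IsSmoothModel.exists_eq (hmodel : IsSmoothModel (m := m) g Ω π ϕ) (p : 𝓜) :
    ∃ q ∈ nonGrazing g Ω, π q = p :=
  hmodel.surjOn_proj (mem_univ p)

theorem IsSmoothModel.zero_mem (hg : IsComplete g) (hΩ : IsObstacle n Ω)
    (hmodel : IsSmoothModel (m := m) g Ω π ϕ) (p : 𝓜) : (0, p) ∈ modelDomain g Ω π := by
  obtain ⟨q, hq, rfl⟩ := hmodel.exists_eq p
  exact mem_modelDomain (p := (0, q)) (eventually_mem_billiardDomain hg hΩ hq).self_of_nhds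

theorem IsSmoothModel.continuousAt_flow (hmodel : IsSmoothModel (m := m) g Ω π ϕ)
    {p : ℝ × 𝓜} (hp : p ∈ modelDomain g Ω π) :
    ContinuousAt (fun p : ℝ × 𝓜 => ϕ p.1 p.2) p :=
  hmodel.contMDiffOn_flow.continuousOn.continuousAt (hmodel.isOpen_domain.mem_nhds hp)

theorem IsSmoothModel.tendsto_flow_zero (hg : IsComplete g) (hΩ : IsObstacle n Ω)
    (hmodel : IsSmoothModel (m := m) g Ω π ϕ) (p : 𝓜) :
    Filter.Tendsto (fun t => ϕ t p) (𝓝 0) (𝓝 p) := by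
  have h := (hmodel.continuousAt_flow (hmodel.zero_mem hg hΩ p)).tendsto
  simp only [hmodel.flow_zero] at h
  exact h.comp (Continuous.prodMk continuous_id continuous_const : Continuous fun t : ℝ => (t, p)).continuousAt.tendsto

theorem IsSmoothModel.injOn_interior (hmodel : IsSmoothModel (m := m) g Ω π ϕ) :
    InjOn π (phaseInterior g Ω) := by
  obtain ⟨ψ, -, hψ⟩ := hmodel.exists_inverse
  intro a ha b hb hab
  rw [← hψ a ha, hab, hψ b hb]

/-- The trajectories of two points in the same fiber of `π` agree for small positive times. -/
theorem IsSmoothModel.eventually_billiardFlow_eq (hg : IsComplete g) (hΩ : IsObstacle n Ω)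
    (hmodel : IsSmoothModel (m := m) g Ω π ϕ) {q₁ q₂ : TangentBundle (𝓡 n) Q}
    (h₁ : q₁ ∈ nonGrazing g Ω) (h₂ : q₂ ∈ nonGrazing g Ω) (h : π q₁ = π q₂) :
    ∀ᶠ t in 𝓝[>] (0 : ℝ), billiardFlow g Ω t q₁ = billiardFlow g Ω t q₂ := by
  filter_upwards [eventually_billiardFlow_pos hg hΩ h₁, eventually_billiardFlow_pos hg hΩ h₂,
    nhdsWithin_le_nhds (eventually_mem_billiardDomain hg hΩ h₁),
    nhdsWithin_le_nhds (eventually_mem_billiardDomain hg hΩ h₂)] with t a1 a2 d1 d2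
  refine hmodel.injOn_interior a1.2 a2.2 ?_
  rw [← hmodel.intertwine _ d1, ← hmodel.intertwine _ d2, h]

/-- Let `t → 0` from above in the common trajectory. Consequently two points of one fiber are equal
or reflections of each other. -/
theorem IsSmoothModel.start_eq [T2Space Q] (hg : IsComplete g) (hΩ : IsObstacle n Ω)
    (hmodel : IsSmoothModel (m := m) g Ω π ϕ) {q₁ q₂ : TangentBundle (𝓡 n) Q}
    (h₁ : q₁ ∈ nonGrazing g Ω) (h₂ : q₂ ∈ nonGrazing g Ω) (h : π q₁ = π q₂) :
    start g Ω 1 q₁ = start g Ω 1 q₂ := by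
  have hlim : ∀ q, Filter.Tendsto (fun t => geodesicFlow g t q) (𝓝[>] 0) (𝓝 q) := fun q =>
    ((continuous_geodesicFlow hg q).tendsto' 0 q (geodesicFlow_zero hg q)).mono_left
      nhdsWithin_le_nhds
  refine tendsto_nhds_unique_tangentBundle (hlim (start g Ω 1 q₁))
    ((hlim (start g Ω 1 q₂)).congr' ?_)
  filter_upwards [eventually_billiardFlow_pos hg hΩ h₁, eventually_billiardFlow_pos hg hΩ h₂,
    hmodel.eventually_billiardFlow_eq hg hΩ h₁ h₂ h] with t a1 a2 e
  rw [← a1.1, ← a2.1, e]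

/-- The base points agree and lie off `Ω`, so `start` changes neither vector. Injectivity of `π` on
the interior alone would not exclude a boundary point in the fiber. -/
theorem IsSmoothModel.eq_of_mem_interior [T2Space Q] (hg : IsComplete g) (hΩ : IsObstacle n Ω)
    (hmodel : IsSmoothModel (m := m) g Ω π ϕ) {q₁ q₂ : TangentBundle (𝓡 n) Q}
    (h₁ : q₁ ∈ nonGrazing g Ω) (h₂ : q₂ ∈ phaseInterior g Ω) (h : π q₁ = π q₂) : q₁ = q₂ := by
  have hs := hmodel.start_eq hg hΩ h₁ (phaseInterior_subset hΩ.1 h₂) h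
  rw [start_of_notMem hΩ.1 1 h₂.2] at hs
  have hb : q₁.1 = q₂.1 := by rw [← hs, start_fst]
  rwa [start_of_notMem hΩ.1 1 (by rw [hb]; exact h₂.2)] at hs

/-- The model domain is an image, so a time admissible for `π q` might come from another point of
the fiber; over the interior there is no other point. -/
theorem IsSmoothModel.mem_billiardDomain [T2Space Q] (hg : IsComplete g) (hΩ : IsObstacle n Ω)
    (hmodel : IsSmoothModel (m := m) g Ω π ϕ) {s : ℝ} {q : TangentBundle (𝓡 n) Q}
    (hq : q ∈ phaseInterior g Ω) (h : (s, π q) ∈ modelDomain g Ω π) :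
    (s, q) ∈ billiardDomain g Ω := by
  obtain ⟨⟨s', q'⟩, hp, he⟩ := h
  obtain ⟨h1, h2⟩ := Prod.mk.inj he
  rw [← hmodel.eq_of_mem_interior hg hΩ hp.1 hq h2, ← h1]
  exact hp

/-- The trajectory of `q` may jump at time 0, but its image under `π` is a trajectory of the model
flow and is continuous there. -/
theorem IsSmoothModel.eventually_mem_preimage (hg : IsComplete g) (hΩ : IsObstacle n Ω)
    (hmodel : IsSmoothModel (m := m) g Ω π ϕ) {𝒪 : Set 𝓜} (h𝒪 : IsOpen 𝒪)
    {q : TangentBundle (𝓡 n) Q} (hq : q ∈ preimageInPhase g Ω π 𝒪) :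
    ∀ᶠ t : ℝ in 𝓝 0, (t, q) ∈ billiardDomain g Ω ∧
      billiardFlow g Ω t q ∈ preimageInPhase g Ω π 𝒪 := by
  filter_upwards [eventually_mem_billiardDomain hg hΩ hq.1,
    (hmodel.tendsto_flow_zero hg hΩ (π q)).eventually (h𝒪.mem_nhds hq.2)] with t hD ht
  refine ⟨hD, billiardFlow_mem_nonGrazing hg hΩ hD, ?_⟩
  rw [mem_preimage, ← hmodel.intertwine _ hD]
  exact ht

/-- Billiard functions are constant on the fibers of `π`. -/
theorem IsSmoothModel.billiardFunction_eq (hg : IsComplete g) (hΩ : IsObstacle n Ω)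
    (hmodel : IsSmoothModel (m := m) g Ω π ϕ) {𝒪 : Set 𝓜} (h𝒪 : IsOpen 𝒪)
    {f : preimageInPhase g Ω π 𝒪 → ℂ} (hf : f ∈ billiardFunctions g Ω (preimageInPhase g Ω π 𝒪))
    (q₁ q₂ : preimageInPhase g Ω π 𝒪) (h : π q₁ = π q₂) : f q₁ = f q₂ := by
  have hlim : ∀ q : preimageInPhase g Ω π 𝒪, Filter.Tendsto
      (fun t => extendZero f (billiardFlow g Ω t q.1)) (𝓝[>] 0) (𝓝 (f q)) := by
    intro q
    have hev := hmodel.eventually_mem_preimage hg hΩ h𝒪 q.2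
    have hc := hf.2.continuousOn (0, q.1) hev.self_of_nhds
    have h1 : Filter.Tendsto (fun t : ℝ => (t, q.1)) (𝓝[>] 0)
        (𝓝[{p ∈ billiardDomain g Ω | billiardFlow g Ω p.1 p.2 ∈ preimageInPhase g Ω π 𝒪}]
          (0, q.1)) := by
      refine tendsto_nhdsWithin_iff.2 ⟨?_, nhdsWithin_le_nhds hev⟩
      exact ((Continuous.prodMk continuous_id continuous_const :
        Continuous fun t : ℝ => (t, q.1)).tendsto 0).mono_left nhdsWithin_le_nhds
    have h2 := hc.tendsto.comp h1
    rw [show extendZero f (billiardFlow g Ω 0 q.1) = f q by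
      rw [billiardFlow_zero, extendZero_apply _ q.2]] at h2
    exact h2
  refine tendsto_nhds_unique (hlim q₁) ((hlim q₂).congr' ?_)
  filter_upwards [hmodel.eventually_billiardFlow_eq hg hΩ q₁.2.1 q₂.2.1 h] with t ht
  rw [ht]

/-- Every point of the model reaches the image of the interior in a short time, in either
direction of time. -/
theorem IsSmoothModel.eventually_mem_image (hg : IsComplete g) (hΩ : IsObstacle n Ω)
    (hmodel : IsSmoothModel (m := m) g Ω π ϕ) {σ : ℝ} (hσ : σ = 1 ∨ σ = -1) (p : 𝓜) :
    ∀ᶠ t in 𝓝[>] (0 : ℝ), ∀ᶠ p' in 𝓝 p, (σ * t, p') ∈ modelDomain g Ω π ∧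
      ϕ (σ * t) p' ∈ π '' phaseInterior g Ω ∧ (-(σ * t), ϕ (σ * t) p') ∈ modelDomain g Ω π := by
  obtain ⟨q, hq, rfl⟩ := hmodel.exists_eq p
  have hcσ : Filter.Tendsto (fun t : ℝ => σ * t) (𝓝 0) (𝓝 0) :=
    (continuous_const.mul continuous_id).tendsto' _ _ (by simp)
  have h1 := hcσ.eventually (eventually_mem_billiardDomain hg hΩ hq)
  have h2 : ∀ᶠ t in 𝓝[>] (0 : ℝ), billiardFlow g Ω (σ * t) q ∈ phaseInterior g Ω := by
    rcases hσ with rfl | rfl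
    · simp only [one_mul]
      exact (eventually_billiardFlow_pos hg hΩ hq).mono fun t ht => ht.2
    · simp only [neg_one_mul]
      exact (eventually_billiardFlow_neg hg hΩ hq).mono fun t ht => ht.2
  -- The group law holds only within the domain, so the time for flowing back must be admissible
  -- too.
  have h3 : ∀ᶠ t in 𝓝 (0 : ℝ), (-(σ * t), ϕ (σ * t) (π q)) ∈ modelDomain g Ω π := by
    have hc : Filter.Tendsto (fun t => (-(σ * t), ϕ (σ * t) (π q))) (𝓝 0) (𝓝 (0, π q)) := by
      refine Filter.Tendsto.prodMk_nhds ?_ ((hmodel.tendsto_flow_zero hg hΩ (π q)).comp hcσ)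
      simpa using hcσ.neg
    exact hc.eventually (hmodel.isOpen_domain.mem_nhds (hmodel.zero_mem hg hΩ (π q)))
  filter_upwards [nhdsWithin_le_nhds h1, h2, nhdsWithin_le_nhds h3] with t ht1 ht2 ht3
  have hD := mem_modelDomain (π := π) ht1
  have hpair : Continuous fun p' : 𝓜 => (σ * t, p') :=
    Continuous.prodMk continuous_const continuous_id
  have hflow : ContinuousAt (fun p' => ϕ (σ * t) p') (π q) :=
    ContinuousAt.comp_of_eq (g := fun p : ℝ × 𝓜 => ϕ p.1 p.2) (hmodel.continuousAt_flow hD)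
      hpair.continuousAt rfl
  have hpair2 : ContinuousAt (fun p' => (-(σ * t), ϕ (σ * t) p')) (π q) :=
    continuousAt_const.prodMk hflow
  have him : ϕ (σ * t) (π q) ∈ π '' phaseInterior g Ω :=
    ⟨_, ht2, (hmodel.intertwine _ ht1).symm⟩
  exact (hpair.continuousAt.eventually (hmodel.isOpen_domain.mem_nhds hD)).and
    ((hflow.eventually (hmodel.isOpen_image.mem_nhds him)).and
      (hpair2.eventually (hmodel.isOpen_domain.mem_nhds ht3)))

/-- If the model flow takes `p'` to the image of an interior point, then the billiard flow takes
this interior point back to the fiber over `p'`. -/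
theorem IsSmoothModel.backward_flow [T2Space Q] (hg : IsComplete g) (hΩ : IsObstacle n Ω)
    (hmodel : IsSmoothModel (m := m) g Ω π ϕ) {t : ℝ} {p : 𝓜} {q : TangentBundle (𝓡 n) Q}
    (hq : q ∈ phaseInterior g Ω) (h1 : (t, p) ∈ modelDomain g Ω π) (h2 : π q = ϕ t p)
    (h3 : (-t, ϕ t p) ∈ modelDomain g Ω π) :
    (-t, q) ∈ billiardDomain g Ω ∧ billiardFlow g Ω (-t) q ∈ nonGrazing g Ω ∧
      π (billiardFlow g Ω (-t) q) = p := by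
  have hD := hmodel.mem_billiardDomain hg hΩ hq (by rwa [h2] : (-t, π q) ∈ modelDomain g Ω π)
  refine ⟨hD, billiardFlow_mem_nonGrazing hg hΩ hD, ?_⟩
  rw [← hmodel.intertwine _ hD]
  simp only [h2]
  rw [hmodel.flow_add _ _ _ h1 h3 (by rw [neg_add_cancel]; exact hmodel.zero_mem hg hΩ p),
    neg_add_cancel, hmodel.flow_zero]

/-- Functions on the model whose pullback is a billiard function are smooth. -/
theorem IsSmoothModel.mem_smoothFunctions [T2Space Q] (hg : IsComplete g)
    (hΩ : IsObstacle n Ω) (hmodel : IsSmoothModel (m := m) g Ω π ϕ) {𝒪 : Set 𝓜} (h𝒪 : IsOpen 𝒪)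
    {h : 𝒪 → ℂ}
    (hf : pullback g Ω π 𝒪 h ∈ billiardFunctions g Ω (preimageInPhase g Ω π 𝒪)) :
    h ∈ smoothFunctions (𝓡 m) 𝒪 := by
  obtain ⟨ψ, hψs, hψ⟩ := hmodel.exists_inverse
  intro p hp
  obtain ⟨t, ht⟩ := (hmodel.eventually_mem_image hg hΩ (Or.inl rfl) p).exists
  simp only [one_mul] at ht
  set W := {p' | p' ∈ 𝒪 ∧ (t, p') ∈ modelDomain g Ω π ∧ ϕ t p' ∈ π '' phaseInterior g Ω ∧
    (-t, ϕ t p') ∈ modelDomain g Ω π} with hW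
  have hWn : W ∈ 𝓝 p := Filter.Eventually.and (h𝒪.mem_nhds hp) ht
  have hback : ∀ p' ∈ W, (-t, ψ (ϕ t p')) ∈ billiardDomain g Ω ∧
      billiardFlow g Ω (-t) (ψ (ϕ t p')) ∈ nonGrazing g Ω ∧
        π (billiardFlow g Ω (-t) (ψ (ϕ t p'))) = p' := by
    rintro p' ⟨-, h1, ⟨q, hq, hqp⟩, h3⟩
    rw [← hqp, hψ q hq]
    exact hmodel.backward_flow hg hΩ hq h1 hqp h3
  have hψϕ : ContMDiffOn (𝓡 m) (𝓡 n).tangent ∞ (fun p' => ψ (ϕ t p')) W := by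
    refine hψs.comp (hmodel.contMDiffOn_flow.comp
      (contMDiff_const.prodMk contMDiff_id).contMDiffOn (fun p' hp' => hp'.2.1))
      (fun p' hp' => hp'.2.2.1)
  -- The point reached by `φ_{-t}` may lie on the boundary, where `φ` need not be continuous.
  -- Smoothness is taken from `f ∘ φ` as a whole.
  have hcomp := hf.2.comp (s := W)
    ((contMDiffOn_const (c := -t)).prodMk hψϕ : ContMDiffOn (𝓡 m)
      (𝓘(ℝ, ℝ).prod (𝓡 n).tangent) ∞ (fun p' => (-t, ψ (ϕ t p'))) W)
    (fun p' hp' => by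
      obtain ⟨b1, b2, b3⟩ := hback p' hp'
      exact ⟨b1, b2, by rw [mem_preimage, b3]; exact hp'.1⟩)
  have hon : ContMDiffOn (𝓡 m) 𝓘(ℝ, ℂ) ∞ (extendZero h) W := by
    refine hcomp.congr fun p' hp' => ?_
    obtain ⟨b1, b2, b3⟩ := hback p' hp'
    have hO : billiardFlow g Ω (-t) (ψ (ϕ t p')) ∈ preimageInPhase g Ω π 𝒪 :=
      ⟨b2, by rw [mem_preimage, b3]; exact hp'.1⟩
    rw [extendZero_apply _ hp'.1, Function.comp_apply, extendZero_apply _ hO]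
    exact congrArg h (Subtype.ext b3.symm)
  exact (hon.contMDiffAt hWn).contMDiffWithinAt

/-- The pullback of a smooth function on the model is a billiard function. -/
theorem IsSmoothModel.pullback_mem (hmodel : IsSmoothModel (m := m) g Ω π ϕ) {𝒪 : Set 𝓜}
    {h : 𝒪 → ℂ} (hh : h ∈ smoothFunctions (𝓡 m) 𝒪) :
    pullback g Ω π 𝒪 h ∈ billiardFunctions g Ω (preimageInPhase g Ω π 𝒪) := by
  have hext : ∀ q ∈ preimageInPhase g Ω π 𝒪,
      extendZero (pullback g Ω π 𝒪 h) q = extendZero h (π q) := by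
    intro q hq
    exact (extendZero_apply _ hq).trans (extendZero_apply h hq.2).symm
  have hh' : ContMDiffOn (𝓡 m) 𝓘(ℝ, ℂ) ∞ (extendZero h) 𝒪 := hh
  constructor
  · exact (hh'.comp (hmodel.contMDiffOn_proj.mono inter_subset_left)
      (fun q hq => hq.2)).congr hext
  · have hπ : ContMDiffOn (𝓘(ℝ, ℝ).prod (𝓡 n).tangent) (𝓘(ℝ, ℝ).prod (𝓡 m)) ∞
        (fun p : ℝ × TangentBundle (𝓡 n) Q => (p.1, π p.2)) (billiardDomain g Ω) :=
      contMDiffOn_fst.prodMk (hmodel.contMDiffOn_proj.comp contMDiffOn_snd fun p hp => hp.1)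
    have hflow := hmodel.contMDiffOn_flow.comp hπ fun p hp => mem_modelDomain hp
    set S := {p ∈ billiardDomain g Ω | billiardFlow g Ω p.1 p.2 ∈ preimageInPhase g Ω π 𝒪}
    have hS : S ⊆ billiardDomain g Ω := fun p hp => hp.1
    have h1 := hh'.comp (hflow.mono hS) (fun p hp => by
      simp only [mem_preimage, Function.comp_apply, hmodel.intertwine p hp.1]
      exact hp.2.2)
    refine h1.congr fun p hp => ?_
    rw [hext _ hp.2]
    simp only [Function.comp_apply, hmodel.intertwine p hp.1]

/-! ### Properness of the projection -/

theorem start_mem_nonGrazing (hΩ : IsObstacle n Ω) (σ : ℝ) {q : TangentBundle (𝓡 n) Q}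
    (hq : q ∈ nonGrazing g Ω) : start g Ω σ q ∈ nonGrazing g Ω := by
  rcases start_eq_or (g := g) (Ω := Ω) σ q with h | ⟨h1, h⟩ <;> rw [h]
  · exact hq
  · exact reflect_mem_nonGrazing hΩ hq h1

/-- Over the boundary, `start` for `σ = -1` is always the inward (arriving) vector and for `σ = 1`
the outward (departing) one; one of the two is `q`. -/
theorem reflect_start_neg_one (hΩ : IsObstacle n Ω) {q : TangentBundle (𝓡 n) Q}
    (hf : q.1 ∈ frontier Ω) (hn : normalComponent g Ω q ≠ 0) :
    reflect g Ω (start g Ω (-1) q) = start g Ω 1 q := by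
  rcases hn.lt_or_gt with h | h
  · rw [start, if_pos ⟨hf, by linarith⟩, start, if_neg (fun h' => by linarith [h'.2]),
      reflect_reflect g hΩ hf]
  · rw [start, if_neg (fun h' => by linarith [h'.2]), start, if_pos ⟨hf, by linarith⟩]

/-- Close to a boundary point, a trajectory collides at most once in a short time: points close to
the inward vector `a` are transported to points close to `a` or to its reflection. -/
theorem exists_advance_mem [T2Space Q] (hg : IsComplete g) (hΩ : IsObstacle n Ω)
    {a : TangentBundle (𝓡 n) Q} (hf : a.1 ∈ frontier Ω) (ha : 0 < normalComponent g Ω a)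
    {N₁ N₂ : Set (TangentBundle (𝓡 n) Q)} (hN₁ : N₁ ∈ 𝓝 a) (hN₂ : N₂ ∈ 𝓝 (reflect g Ω a)) :
    ∃ ε > 0, ∀ᶠ q in 𝓝 a, q ∈ phaseInterior g Ω → ∀ t ∈ Ioo 0 ε,
      advance g Ω 1 t q ∈ N₁ ∪ N₂ := by
  obtain ⟨hnc, hrefl⟩ := tendsto_normalComponent_reflect g hΩ hf
  obtain ⟨ε₁, hε₁, h₁⟩ := exists_geodesicFlow_mem hg hN₂
  obtain ⟨ε₂, hε₂, h₂⟩ := exists_geodesicFlow_notMem hg hΩ (q₀ := reflect g Ω a) hf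
    (by rw [normalComponent_reflect g hΩ hf]; linarith)
  -- For arrival points near `a`: the reflected geodesic stays in `N₂` for time `ε₁` and off `Ω` for
  -- time `ε₂`, and the arrival is not grazing.
  have hev := Filter.eventually_inf_principal.1
    ((hrefl.eventually (h₁.and h₂)).and (hnc.eventually (lt_mem_nhds ha)))
  obtain ⟨ε₃, hε₃, h₃⟩ := exists_geodesicFlow_mem hg (Filter.inter_mem hN₁ hev)
  refine ⟨min ε₁ (min ε₂ ε₃), lt_min hε₁ (lt_min hε₂ hε₃), ?_⟩
  filter_upwards [h₃] with q hq hqi t ht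
  have ht₁ : t < ε₁ := ht.2.trans_le (min_le_left _ _)
  have ht₂ : t < ε₂ := ht.2.trans_le ((min_le_right _ _).trans (min_le_left _ _))
  have ht₃ : t < ε₃ := ht.2.trans_le ((min_le_right _ _).trans (min_le_right _ _))
  have hs : start g Ω 1 q = q := start_of_notMem hΩ.1 1 hqi.2
  have hqn := phaseInterior_subset hΩ.1 hqi
  rcases le_or_gt (t : EReal) (hitTime g Ω 1 q) with hle | hlt
  · rw [advance_eq hle, hs, one_mul]
    exact Or.inl (hq hqi.1 t ⟨ht.1.le, ht₃⟩).1
  · have htop := ne_top_of_lt hlt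
    have hT := hitTime_coe_toReal hg hΩ hqn one_ne_zero htop
    have hpos := hitTime_pos hg hΩ hqn one_ne_zero
    have hbd := hitPoint_fst_mem hg hΩ hqn one_ne_zero htop
    have hhit : hitPoint g Ω 1 q = geodesicFlow g (hitTime g Ω 1 q).toReal q := by
      rw [hitPoint, hs, one_mul]
    set T := (hitTime g Ω 1 q).toReal with hTdef
    rw [← hT, EReal.coe_pos] at hpos
    have hTt : T < t := by rwa [← hT, EReal.coe_lt_coe_iff] at hlt
    obtain ⟨-, hB⟩ := hq hqi.1 T ⟨hpos.le, hTt.trans ht₃⟩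
    rw [← hhit] at hB
    obtain ⟨⟨hr1, hr2⟩, hn⟩ := hB hbd
    have hunit : reflect g Ω (hitPoint g Ω 1 q) ∈ unitBundle g := by
      refine reflect_mem_unitBundle g hΩ hbd ?_
      rw [hhit]
      exact geodesicFlow_mem_unitBundle hg hqi.1 T
    have hst : start g Ω 1 (hitPoint g Ω 1 q) = reflect g Ω (hitPoint g Ω 1 q) := by
      rw [start, if_pos ⟨hbd, by rwa [one_mul]⟩]
    -- No second collision before time `t`: after the first one less than `ε₂` of time is left.
    have hnext : ((t - T : ℝ) : EReal) ≤ hitTime g Ω 1 (hitPoint g Ω 1 q) := by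
      refine le_hitTime fun s hs' => ?_
      rw [hst, one_mul]
      exact hr2 hunit hbd s ⟨hs'.1, by linarith [hs'.2]⟩
    rw [advance_eq_of_one_collision hlt (fun h => hn.ne' h.2.2) hnext, hst, one_mul]
    exact Or.inr (hr1 hunit _ ⟨by linarith, by linarith⟩)

theorem start_neg_one_normalComponent_pos (hΩ : IsObstacle n Ω) {q : TangentBundle (𝓡 n) Q}
    (hf : q.1 ∈ frontier Ω) (hn : normalComponent g Ω q ≠ 0) :
    0 < normalComponent g Ω (start g Ω (-1) q) := by
  have := mul_normalComponent_start_neg (σ := -1) hΩ hf hn (by norm_num)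
  linarith

/-- The fibers of `π` near the fiber of `q` are close to the two vectors with which the geodesics
through `q` end and start. -/
theorem IsSmoothModel.eventually_fiber_subset [T2Space Q] (hg : IsComplete g)
    (hΩ : IsObstacle n Ω) (hmodel : IsSmoothModel (m := m) g Ω π ϕ) {q : TangentBundle (𝓡 n) Q}
    (hq : q ∈ nonGrazing g Ω) {N₁ N₂ : Set (TangentBundle (𝓡 n) Q)}
    (hN₁ : N₁ ∈ 𝓝 (start g Ω (-1) q)) (hN₂ : N₂ ∈ 𝓝 (start g Ω 1 q)) :
    ∀ᶠ p in 𝓝 (π q), ∀ q' ∈ nonGrazing g Ω, π q' = p → q' ∈ N₁ ∪ N₂ := by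
  obtain ⟨ψ, hψs, hψ⟩ := hmodel.exists_inverse
  have hψc : ∀ p ∈ π '' phaseInterior g Ω, ContinuousAt ψ p := fun p hp =>
    hψs.continuousOn.continuousAt (hmodel.isOpen_image.mem_nhds hp)
  rcases mem_phaseInterior_or q hq with hi | ⟨hf, hn⟩
  · have hmem : π q ∈ π '' phaseInterior g Ω := ⟨q, hi, rfl⟩
    rw [start_of_notMem hΩ.1 1 hi.2, ← hψ q hi] at hN₂
    filter_upwards [hmodel.isOpen_image.mem_nhds hmem, (hψc _ hmem).eventually hN₂] with p hp hpN
    rintro q' hq' rfl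
    obtain ⟨q'', hq'', he⟩ := hp
    rw [← he, hψ q'' hq''] at hpN
    rw [hmodel.eq_of_mem_interior hg hΩ hq' hq'' he.symm]
    exact Or.inr hpN
  set a := start g Ω (-1) q with ha
  have haf : a.1 ∈ frontier Ω := by rw [ha, start_fst]; exact hf
  have hrefl : reflect g Ω a = start g Ω 1 q := reflect_start_neg_one hΩ hf hn
  rw [← hrefl] at hN₂
  -- Both neighborhoods are shrunk so that reflection maps boundary points of each into the other;
  -- the end of the proof may then replace a point by its reflection.
  have hN₁' : ∀ᶠ q' in 𝓝 a, q' ∈ N₁ ∧ (q'.1 ∈ frontier Ω → reflect g Ω q' ∈ N₂) :=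
    Filter.Eventually.and hN₁ (Filter.eventually_inf_principal.1
      ((tendsto_normalComponent_reflect g hΩ haf).2.eventually hN₂))
  have hN₂' : ∀ᶠ q' in 𝓝 (reflect g Ω a), q' ∈ N₂ ∧ (q'.1 ∈ frontier Ω → reflect g Ω q' ∈ N₁) := by
    refine Filter.Eventually.and hN₂ (Filter.eventually_inf_principal.1
      ((tendsto_normalComponent_reflect g hΩ (q₀ := reflect g Ω a) haf).2.eventually ?_))
    rwa [reflect_reflect g hΩ haf]
  obtain ⟨ε, hε, hadv⟩ := exists_advance_mem hg hΩ haf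
    (start_neg_one_normalComponent_pos hΩ hf hn) hN₁' hN₂'
  have hback : Filter.Tendsto (fun t => geodesicFlow g (-t) a) (𝓝[>] 0) (𝓝 a) :=
    (((continuous_geodesicFlow hg a).comp continuous_neg).tendsto' 0 a
      (by simp [geodesicFlow_zero hg])).mono_left nhdsWithin_le_nhds
  have hD : ∀ᶠ t in 𝓝[>] (0 : ℝ), (-t, q) ∈ billiardDomain g Ω :=
    nhdsWithin_le_nhds ((continuous_neg.tendsto' (0 : ℝ) 0 neg_zero).eventually
      (eventually_mem_billiardDomain hg hΩ hq))
  -- One time `t < ε` at which the backward trajectory of `q` is an interior point so close to `a`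
  -- that `exists_advance_mem` applies to all vectors near it.
  obtain ⟨t, ⟨⟨⟨ht1, -⟩, ht3⟩, ht4⟩, ht5, ht6⟩ :=
    ((((eventually_billiardFlow_neg hg hΩ hq).and (hback.eventually
      hadv.eventually_nhds)).and ((hmodel.eventually_mem_image hg hΩ (Or.inr rfl) (π q)))).and
      (hD.and (Ioo_mem_nhdsGT hε))).exists
  simp only [neg_one_mul] at ht4
  have hmemD := ht4.self_of_nhds
  have hval : ψ (ϕ (-t) (π q)) = geodesicFlow g (-t) a := by
    obtain ⟨q'', hq'', he⟩ := hmemD.2.1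
    have h1 := hmodel.intertwine _ ht5
    simp only at h1
    rw [← he, hψ q'' hq'', ← ht1]
    rw [← he] at h1
    exact (hmodel.eq_of_mem_interior hg hΩ (billiardFlow_mem_nonGrazing hg hΩ ht5) hq''
      h1.symm).symm
  have hcont : Filter.Tendsto (fun p => ψ (ϕ (-t) p)) (𝓝 (π q)) (𝓝 (geodesicFlow g (-t) a)) := by
    rw [← hval]
    exact ContinuousAt.comp_of_eq (hψc _ hmemD.2.1) (ContinuousAt.comp_of_eq
      (g := fun p : ℝ × 𝓜 => ϕ p.1 p.2) (hmodel.continuousAt_flow hmemD.1)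
      (continuousAt_const.prodMk continuousAt_id) rfl) rfl
  filter_upwards [ht4, hcont.eventually ht3] with p hp hpadv q' hq' hπ
  obtain ⟨hp1, ⟨b, hb, hbp⟩, hp3⟩ := hp
  rw [← hbp, hψ b hb] at hpadv
  obtain ⟨-, hc1, hc2⟩ := hmodel.backward_flow hg hΩ hb hp1 hbp hp3
  have hadv' := hpadv hb t ht6
  rw [neg_neg, billiardFlow, if_pos ht6.1] at hc1 hc2
  -- The interior point `b` over `ϕ_{-t} p` flows forward to `c`, which lies in the fiber over `p`
  -- and in one of the neighborhoods. The given `q'` in this fiber has the same `start`, so it is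
  -- `c` or its reflection.
  set c := advance g Ω 1 t b
  have hst := hmodel.start_eq hg hΩ hq' hc1 (hπ.trans hc2.symm)
  have hcase : q' = c ∨ c.1 ∈ frontier Ω ∧ q' = reflect g Ω c := by
    have hbase : q'.1 = c.1 := by
      rw [← start_fst (g := g) (Ω := Ω) 1 q', hst, start_fst]
    rcases start_eq_or (g := g) (Ω := Ω) 1 q' with h1 | ⟨hf1, h1⟩ <;>
    rcases start_eq_or (g := g) (Ω := Ω) 1 c with h2 | ⟨hf2, h2⟩ <;>
    rw [h1, h2] at hst
    · exact Or.inl hst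
    · exact Or.inr ⟨hf2, hst⟩
    · refine Or.inr ⟨hbase ▸ hf1, ?_⟩
      rw [← hst, reflect_reflect g hΩ hf1]
    · refine Or.inl ?_
      rw [← reflect_reflect g hΩ hf1, hst, reflect_reflect g hΩ hf2]
  rcases hcase with rfl | ⟨hcf, rfl⟩
  · exact hadv'.imp (fun h => h.1) (fun h => h.1)
  · exact (hadv'.imp (fun h => h.2 hcf) (fun h => h.2 hcf)).symm

/-- The projection to a smooth model is proper. -/
theorem IsSmoothModel.isCompact_preimage [T2Space Q] [T2Space 𝓜] (hg : IsComplete g)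
    (hΩ : IsObstacle n Ω) (hmodel : IsSmoothModel (m := m) g Ω π ϕ) {K : Set 𝓜}
    (hK : IsCompact K) : IsCompact (nonGrazing g Ω ∩ π ⁻¹' K) := by
  rw [isCompact_iff_ultrafilter_le_nhds]
  intro F hF
  rw [Filter.le_principal_iff] at hF
  have hFn : nonGrazing g Ω ∈ F := Filter.mem_of_superset hF inter_subset_left
  have hFK : K ∈ F.map π :=
    Ultrafilter.mem_map.2 (Filter.mem_of_superset hF inter_subset_right)
  obtain ⟨p, hpK, hp⟩ := isCompact_iff_ultrafilter_le_nhds.1 hK (F.map π)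
    (Filter.le_principal_iff.2 hFK)
  obtain ⟨q, hq, rfl⟩ := hmodel.exists_eq p
  -- The image ultrafilter converges to `π q`, so `F` clusters at the two vectors at `q`; being an
  -- ultrafilter, it converges to one of them.
  have hle : (F : Filter _) ≤ 𝓝 (start g Ω (-1) q) ⊔ 𝓝 (start g Ω 1 q) := by
    intro s hs
    have h1 := hp (hmodel.eventually_fiber_subset hg hΩ hq hs.1 hs.2)
    filter_upwards [hFn, h1] with q' hq' h
    exact (h q' hq' rfl).elim id id
  have hend : ∀ σ, (F : Filter _) ≤ 𝓝 (start g Ω σ q) →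
      ∃ x ∈ nonGrazing g Ω ∩ π ⁻¹' K, (F : Filter _) ≤ 𝓝 x := by
    intro σ hσ
    have hs := start_mem_nonGrazing hΩ σ hq
    refine ⟨_, ⟨hs, ?_⟩, hσ⟩
    have hlim : Filter.Tendsto π F (𝓝 (π (start g Ω σ q))) :=
      (hmodel.contMDiffOn_proj.continuousOn _ hs).tendsto.mono_left
        (le_inf hσ (Filter.le_principal_iff.2 hFn))
    -- The limit of `F` may be the reflection of `q`; continuity of `π` and uniqueness of limits in
    -- `𝓜` place it in the same fiber, hence over `K`.
    have : π (start g Ω σ q) = π q := tendsto_nhds_unique hlim hp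
    rwa [mem_preimage, this]
  rcases Ultrafilter.le_sup_iff.1 hle with h | h
  · exact hend _ h
  · exact hend _ h

/-- A function on the model has compact support if and only if its pullback has. -/
theorem IsSmoothModel.hasCompactSupport_pullback_iff [T2Space Q] [T2Space 𝓜] (hg : IsComplete g)
    (hΩ : IsObstacle n Ω) (hmodel : IsSmoothModel (m := m) g Ω π ϕ) {𝒪 : Set 𝓜} (h : 𝒪 → ℂ) :
    HasCompactSupport (pullback g Ω π 𝒪 h) ↔ HasCompactSupport h := by
  set π' : preimageInPhase g Ω π 𝒪 → 𝒪 := fun q => ⟨π q.1, q.2.2⟩ with hπ'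
  have hπc : Continuous π' := by
    refine Continuous.subtype_mk ?_ _
    exact continuousOn_iff_continuous_domRestrict.1
      (hmodel.contMDiffOn_proj.continuousOn.mono inter_subset_left)
  have hpull : pullback g Ω π 𝒪 h = h ∘ π' := rfl
  rw [hpull]
  constructor
  · intro hc
    refine HasCompactSupport.intro (hc.isCompact.image hπc) fun p hp => ?_
    by_contra hne
    obtain ⟨q, hq, hqp⟩ := hmodel.exists_eq p.1
    have hqO : q ∈ preimageInPhase g Ω π 𝒪 := ⟨hq, by rw [mem_preimage, hqp]; exact p.2⟩
    have hqp' : π' ⟨q, hqO⟩ = p := Subtype.ext hqp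
    refine hp ⟨⟨q, hqO⟩, subset_tsupport _ ?_, hqp'⟩
    rw [Function.mem_support, Function.comp_apply, hqp']
    exact hne
  · intro hc
    have hK : IsCompact (π' ⁻¹' tsupport h) := by
      rw [Subtype.isCompact_iff]
      have := hmodel.isCompact_preimage hg hΩ (Subtype.isCompact_iff.1 hc.isCompact)
      convert this using 1
      ext q
      constructor
      · rintro ⟨q', hq', rfl⟩
        exact ⟨q'.2.1, ⟨_, hq', rfl⟩⟩
      · rintro ⟨hq, p, hp, hpq⟩
        have hqO : q ∈ preimageInPhase g Ω π 𝒪 := ⟨hq, by rw [mem_preimage, ← hpq]; exact p.2⟩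
        refine ⟨⟨q, hqO⟩, ?_, rfl⟩
        have : π' ⟨q, hqO⟩ = p := Subtype.ext hpq.symm
        rw [mem_preimage, this]
        exact hp
    exact hK.of_isClosed_subset (isClosed_tsupport _)
      (closure_minimal (fun q hq => subset_tsupport h hq) ((isClosed_tsupport h).preimage hπc))

end Model

/-! ### The model generator and the range of the pullback -/

section Generator

variable {n m : ℕ} {Q : Type*} [TopologicalSpace Q] [ChartedSpace (EuclideanSpace ℝ (Fin n)) Q]
  [IsManifold (𝓡 n) ∞ Q] {g : Metric n Q} {Ω : Set Q}
  {𝓜 : Type*} [TopologicalSpace 𝓜] [ChartedSpace (EuclideanSpace ℝ (Fin m)) 𝓜]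
  {π : TangentBundle (𝓡 n) Q → 𝓜} {ϕ : ℝ → 𝓜 → 𝓜}

/-- Applied to `h ∘ ϕ`, this shows that the generator maps smooth functions to smooth functions. -/
theorem contMDiffAt_deriv_param [IsManifold (𝓡 m) ∞ 𝓜] {F : 𝓜 → ℝ → ℂ} {p : 𝓜}
    (hF : ContMDiffAt ((𝓡 m).prod 𝓘(ℝ, ℝ)) 𝓘(ℝ, ℂ) ∞ (Function.uncurry F) (p, 0)) :
    ContMDiffAt (𝓡 m) 𝓘(ℝ, ℂ) ∞ (fun p' => deriv (F p') 0) p := by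
  have h := ContMDiffAt.mfderiv_apply (m := ∞) F (fun _ => (0 : ℝ)) (fun p' : 𝓜 => p')
    (fun _ => (1 : ℝ)) hF contMDiffAt_const contMDiffAt_id contMDiffAt_const (by simp)
  simpa [inTangentCoordinates_model_space, mfderiv_eq_fderiv] using h

theorem IsSmoothModel.contMDiffAt_comp_flow (hg : IsComplete g) (hΩ : IsObstacle n Ω)
    (hmodel : IsSmoothModel (m := m) g Ω π ϕ) {𝒪 : Set 𝓜} (h𝒪 : IsOpen 𝒪)
    {h : 𝒪 → ℂ} (hh : h ∈ smoothFunctions (𝓡 m) 𝒪) {p : 𝓜} (hp : p ∈ 𝒪) :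
    ContMDiffAt (𝓘(ℝ, ℝ).prod (𝓡 m)) 𝓘(ℝ, ℂ) ∞ (fun x : ℝ × 𝓜 => extendZero h (ϕ x.1 x.2))
      (0, p) := by
  have h1 := hmodel.contMDiffOn_flow.contMDiffAt
    (hmodel.isOpen_domain.mem_nhds (hmodel.zero_mem hg hΩ p))
  have hh' : ContMDiffOn (𝓡 m) 𝓘(ℝ, ℂ) ∞ (extendZero h) 𝒪 := hh
  have h2 := hh'.contMDiffAt (h𝒪.mem_nhds hp)
  exact ContMDiffAt.comp_of_eq h2 h1 (hmodel.flow_zero p)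

theorem IsSmoothModel.hasDerivAt_comp_flow (hg : IsComplete g) (hΩ : IsObstacle n Ω)
    (hmodel : IsSmoothModel (m := m) g Ω π ϕ) {𝒪 : Set 𝓜} (h𝒪 : IsOpen 𝒪)
    {h : 𝒪 → ℂ} (hh : h ∈ smoothFunctions (𝓡 m) 𝒪) {p : 𝓜} (hp : p ∈ 𝒪) :
    HasDerivAt (fun t : ℝ => extendZero h (ϕ t p)) (deriv (fun t => extendZero h (ϕ t p)) 0) 0 := by
  have h1 : ContMDiffAt 𝓘(ℝ, ℝ) 𝓘(ℝ, ℂ) ∞ (fun t : ℝ => extendZero h (ϕ t p)) 0 :=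
    ContMDiffAt.comp (g := fun x : ℝ × 𝓜 => extendZero h (ϕ x.1 x.2)) (0 : ℝ)
      (hmodel.contMDiffAt_comp_flow hg hΩ h𝒪 hh hp)
      (contMDiffAt_id.prodMk contMDiffAt_const)
  exact (h1.contDiffAt.differentiableAt (by simp)).hasDerivAt

/-- The generator of the model flow. -/
def modelGenerator [IsManifold (𝓡 m) ∞ 𝓜] (hg : IsComplete g) (hΩ : IsObstacle n Ω)
    (hmodel : IsSmoothModel (m := m) g Ω π ϕ) {𝒪 : Set 𝓜} (h𝒪 : IsOpen 𝒪) :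
    smoothFunctions (𝓡 m) 𝒪 →ₗ[ℂ] smoothFunctions (𝓡 m) 𝒪 where
  toFun h := ⟨fun p => deriv (fun t => extendZero (h : 𝒪 → ℂ) (ϕ t p)) 0, by
    intro p hp
    refine ContMDiffAt.contMDiffWithinAt ?_
    have h1 : ContMDiffAt ((𝓡 m).prod 𝓘(ℝ, ℝ)) 𝓘(ℝ, ℂ) ∞
        (Function.uncurry fun (p' : 𝓜) (t : ℝ) => extendZero (h : 𝒪 → ℂ) (ϕ t p')) (p, 0) :=
      ContMDiffAt.comp (g := fun x : ℝ × 𝓜 => extendZero (h : 𝒪 → ℂ) (ϕ x.1 x.2)) (p, (0 : ℝ))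
        (hmodel.contMDiffAt_comp_flow hg hΩ h𝒪 h.2 hp)
        (contMDiffAt_snd.prodMk contMDiffAt_fst)
    refine (contMDiffAt_deriv_param h1).congr_of_eventuallyEq ?_
    filter_upwards [h𝒪.mem_nhds hp] with p' hp'
    exact extendZero_apply _ hp'⟩
  map_add' h₁ h₂ := by
    ext p
    have e1 := hmodel.hasDerivAt_comp_flow hg hΩ h𝒪 h₁.2 p.2
    have e2 := hmodel.hasDerivAt_comp_flow hg hΩ h𝒪 h₂.2 p.2
    refine HasDerivAt.deriv ?_
    rw [Submodule.coe_add, extendZero_add]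
    exact e1.add e2
  map_smul' c h := by
    ext p
    have e := hmodel.hasDerivAt_comp_flow hg hΩ h𝒪 h.2 p.2
    refine HasDerivAt.deriv ?_
    rw [Submodule.coe_smul, extendZero_smul]
    exact e.const_smul c

theorem isGenerator_modelGenerator [IsManifold (𝓡 m) ∞ 𝓜] (hg : IsComplete g)
    (hΩ : IsObstacle n Ω) (hmodel : IsSmoothModel (m := m) g Ω π ϕ) {𝒪 : Set 𝓜}
    (h𝒪 : IsOpen 𝒪) :
    IsGenerator (smoothFunctions (𝓡 m) 𝒪) ϕ (modelGenerator hg hΩ hmodel h𝒪) :=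
  fun h p => hmodel.hasDerivAt_comp_flow hg hΩ h𝒪 h.2 p.2

/-- The generator is local: from a point off the support of `h`, the flow stays for a short time
where `h` vanishes. -/
theorem hasCompactSupport_modelGenerator [IsManifold (𝓡 m) ∞ 𝓜] (hg : IsComplete g)
    (hΩ : IsObstacle n Ω) (hmodel : IsSmoothModel (m := m) g Ω π ϕ) {𝒪 : Set 𝓜}
    (h𝒪 : IsOpen 𝒪) (h : smoothFunctions (𝓡 m) 𝒪) (hc : HasCompactSupport (h : 𝒪 → ℂ)) :
    HasCompactSupport (modelGenerator hg hΩ hmodel h𝒪 h : 𝒪 → ℂ) := by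
  refine hc.mono' fun p hp => ?_
  by_contra hne
  refine hp ?_
  have h1 : ∀ᶠ p' : 𝒪 in 𝓝 p, (h : 𝒪 → ℂ) p' = 0 := notMem_tsupport_iff_eventuallyEq.1 hne
  have h2 : ∀ᶠ p' : 𝓜 in 𝓝 p.1, extendZero (h : 𝒪 → ℂ) p' = 0 := by
    rw [← h𝒪.nhdsWithin_eq p.2, nhdsWithin_eq_map_subtype_coe p.2]
    refine Filter.eventually_map.2 (h1.mono fun p' hp' => ?_)
    rw [extendZero_apply _ p'.2]
    exact hp'
  have h3 := (hmodel.tendsto_flow_zero hg hΩ p.1).eventually h2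
  refine HasDerivAt.deriv ?_
  exact (hasDerivAt_const (0 : ℝ) (0 : ℂ)).congr_of_eventuallyEq h3

theorem IsSmoothModel.injective_pullback (hmodel : IsSmoothModel (m := m) g Ω π ϕ) (𝒪 : Set 𝓜) :
    Function.Injective (pullback g Ω π 𝒪) := by
  intro h₁ h₂ h
  ext p
  obtain ⟨q, hq, hqp⟩ := hmodel.exists_eq p.1
  have hqO : q ∈ preimageInPhase g Ω π 𝒪 := ⟨hq, by rw [mem_preimage, hqp]; exact p.2⟩
  have h3 := congrFun h ⟨q, hqO⟩
  have h4 : (⟨π q, hqO.2⟩ : 𝒪) = p := Subtype.ext hqp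
  rw [← h4]
  exact h3

/-- Billiard functions are exactly the pullbacks of smooth functions on the model. -/
theorem IsSmoothModel.map_pullback [T2Space Q] (hg : IsComplete g) (hΩ : IsObstacle n Ω)
    (hmodel : IsSmoothModel (m := m) g Ω π ϕ) {𝒪 : Set 𝓜} (h𝒪 : IsOpen 𝒪) :
    (smoothFunctions (𝓡 m) 𝒪).map (pullback g Ω π 𝒪) =
      billiardFunctions g Ω (preimageInPhase g Ω π 𝒪) := by
  refine le_antisymm ?_ fun f hf => ?_
  · rintro _ ⟨h, hh, rfl⟩
    exact hmodel.pullback_mem hh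
  · have hex : ∀ p : 𝒪, ∃ q : preimageInPhase g Ω π 𝒪, π q.1 = p.1 := by
      intro p
      obtain ⟨q, hq, hqp⟩ := hmodel.exists_eq p.1
      exact ⟨⟨q, hq, by rw [mem_preimage, hqp]; exact p.2⟩, hqp⟩
    -- A section of `π` without any continuity: fiberwise constancy makes `f ∘ s` a descent of `f`,
    -- and its smoothness is proved afterwards from that of its pullback.
    choose s hs using hex
    have hpull : pullback g Ω π 𝒪 (fun p => f (s p)) = f := by
      ext q
      exact hmodel.billiardFunction_eq hg hΩ h𝒪 hf _ _ (hs _)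
    exact ⟨fun p => f (s p), hmodel.mem_smoothFunctions hg hΩ h𝒪 (by rwa [hpull]), hpull⟩

end Generator

end Billiard

end

/-! ### The proposition -/

theorem mainTheorem8 {n m : ℕ} (hn : 1 ≤ n)
    {Q : Type*} [TopologicalSpace Q] [T2Space Q] [SecondCountableTopology Q] [ConnectedSpace Q]
    [ChartedSpace (EuclideanSpace ℝ (Fin n)) Q] [IsManifold (𝓡 n) ∞ Q]
    (g : Billiard.Metric n Q) (hg : Billiard.IsComplete g)
    (Ω : Set Q) (hΩ : Billiard.IsObstacle n Ω)
    {𝓜 : Type*} [TopologicalSpace 𝓜] [T2Space 𝓜] [SecondCountableTopology 𝓜]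
    [ChartedSpace (EuclideanSpace ℝ (Fin m)) 𝓜] [IsManifold (𝓡 m) ∞ 𝓜]
    (π : TangentBundle (𝓡 n) Q → 𝓜) (ϕ : ℝ → 𝓜 → 𝓜)
    (hmodel : Billiard.IsSmoothModel (m := m) g Ω π ϕ)
    (𝒪 : Set 𝓜) (h𝒪 : IsOpen 𝒪) :
    let O := Billiard.preimageInPhase g Ω π 𝒪
    let pull := Billiard.pullback g Ω π 𝒪
    let smoothModel := Billiard.smoothFunctions (𝓡 m) 𝒪
    let smoothBill := Billiard.billiardFunctions g Ω O
    -- the pullback maps smooth functions to smooth functions, injectively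
    (∀ h ∈ smoothModel, pull h ∈ Billiard.smoothFunctions (𝓡 n).tangent O) ∧
    Set.InjOn pull smoothModel ∧
    -- its images are the (compactly supported) smooth billiard functions
    smoothModel.map pull = smoothBill ∧
    (smoothModel ⊓ Billiard.compactlySupportedFunctions 𝒪).map pull =
      smoothBill ⊓ Billiard.compactlySupportedFunctions O ∧
    -- the generators exist, preserve compact supports, and are conjugate under the pullback
    ∃ (X : smoothModel →ₗ[ℂ] smoothModel) (P : smoothBill →ₗ[ℂ] smoothBill)
      (pullEquiv : smoothModel ≃ₗ[ℂ] smoothBill),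
      Billiard.IsGenerator smoothModel ϕ X ∧
      Billiard.IsGenerator smoothBill (Billiard.billiardFlow g Ω) P ∧
      (∀ h : smoothModel, (pullEquiv h : O → ℂ) = pull h) ∧
      (∀ h : smoothModel, HasCompactSupport (h : 𝒪 → ℂ) → HasCompactSupport (X h : 𝒪 → ℂ)) ∧
      (∀ f : smoothBill, HasCompactSupport (f : O → ℂ) → HasCompactSupport (P f : O → ℂ)) ∧
      pullEquiv.toLinearMap ∘ₗ X ∘ₗ pullEquiv.symm.toLinearMap = P := by
  intro O pull smoothModel smoothBill
  have hmap : smoothModel.map pull = smoothBill := hmodel.map_pullback hg hΩ h𝒪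
  have hinj : Function.Injective pull := hmodel.injective_pullback 𝒪
  have hsupp : ∀ h, HasCompactSupport (pull h) ↔ HasCompactSupport h := fun h =>
    hmodel.hasCompactSupport_pullback_iff hg hΩ h
  refine ⟨fun h hh => (hmodel.pullback_mem hh).1, hinj.injOn, hmap, ?_, ?_⟩
  · ext f
    constructor
    · rintro ⟨h, ⟨hh, hc⟩, rfl⟩
      exact ⟨hmodel.pullback_mem hh, (hsupp h).2 hc⟩
    · rintro ⟨hf, hc⟩
      obtain ⟨h, hh, rfl⟩ : f ∈ smoothModel.map pull := hmap ▸ hf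
      exact ⟨h, ⟨hh, (hsupp h).1 hc⟩, rfl⟩
  let e : smoothModel ≃ₗ[ℂ] smoothBill :=
    (Submodule.equivMapOfInjective pull hinj smoothModel).trans (LinearEquiv.ofEq _ _ hmap)
  have he : ∀ h : smoothModel, (e h : O → ℂ) = pull h := fun _ => rfl
  let X := Billiard.modelGenerator hg hΩ hmodel h𝒪
  have hX := Billiard.isGenerator_modelGenerator hg hΩ hmodel h𝒪
  have hXc := Billiard.hasCompactSupport_modelGenerator hg hΩ hmodel h𝒪
  -- With `P` defined as the conjugate of `X`, conjugacy is definitional; what remains is that it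
  -- differentiates along the billiard flow and preserves compact supports.
  refine ⟨X, e.toLinearMap ∘ₗ X ∘ₗ e.symm.toLinearMap, e, hX, ?_, he, hXc, ?_, rfl⟩
  · intro f q
    obtain ⟨h, rfl⟩ := e.surjective f
    have hP : (e.toLinearMap ∘ₗ X ∘ₗ e.symm.toLinearMap) (e h) = e (X h) := by simp
    rw [hP]
    -- For `t` near 0 of either sign, the pullback of `h` at `φ_t q` is `h` at `ϕ_t (π q)`, so both
    -- have the same derivative.
    refine (hX h ⟨π q.1, q.2.2⟩).congr_of_eventuallyEq ?_
    filter_upwards [hmodel.eventually_mem_preimage hg hΩ h𝒪 q.2] with t ht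
    refine (Billiard.extendZero_apply _ ht.2).trans ?_
    refine Eq.trans ?_ (congrArg (Billiard.extendZero (h : 𝒪 → ℂ)) (hmodel.intertwine _ ht.1).symm)
    exact (Billiard.extendZero_apply (h : 𝒪 → ℂ) ht.2.2).symm
  · intro f hf
    obtain ⟨h, rfl⟩ := e.surjective f
    rw [he, hsupp] at hf
    have : (e.toLinearMap ∘ₗ X ∘ₗ e.symm.toLinearMap) (e h) = e (X h) := by simp
    rw [this, he, hsupp]
    exact hXc h hf
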